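/- **Terminology.** Let $\mathscr C$ be an additive category with an automorphism $\Sigma\colon\mathscr C\to\mathscr C$ and let $n\ge 3$ be an integer. An *$n$-$\Sigma$-sequence* $A_\bullet$ is a sequence $A_1\xrightarrow{\alpha_1}A_2\xrightarrow{\alpha_2}\cdots\xrightarrow{\alpha_{n-1}}A_n\xrightarrow{\alpha_n}\Sigma A_1$ in $\mathscr C$. Its *left rotation* is $A_2\xrightarrow{\alpha_2}\cdots\xrightarrow{\alpha_n}\Sigma A_1\xrightarrow{(-1)^n\Sigma\alpha_1}\Sigma A_2$. It is a *candidate $n$-angle* if $\alpha_{i+1}\alpha_i=0$ for $1\le i<n$ and $\Sigma\alpha_1\circ\alpha_n=0$. It is *contractible* if there are morphisms $\Theta_i\colon A_{i+1}\to A_i$ ($1\le i<n$) and $\Theta_n\colon\Sigma A_1\to A_n$ with $1_{A_i}=\Theta_i\alpha_i+\alpha_{i-1}\Theta_{i-1}$ for $2\le i\le n$ and $1_{\Sigma A_1}=\Sigma\Theta_1\circ\Sigma\alpha_1+\alpha_n\Theta_n$. A *morphism* $\varphi\colon A_\bullet\to B_\bullet$ is a family $\varphi_i\colon A_i\to B_i$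 ($1\le i\le n$) with $\varphi_{i+1}\alpha_i=\beta_i\varphi_i$ for $1\le i<n$ and $\Sigma\varphi_1\circ\alpha_n=\beta_n\varphi_n$; it is an *isomorphism* if all $\varphi_i$ are. Its *mapping cone* is the sequence $A_2\oplus B_1\to A_3\oplus B_2\to\cdots\to\Sigma A_1\oplus B_n\to\Sigma A_2\oplus\Sigma B_1$ with maps $\left[\begin{smallmatrix}-\alpha_{i+1}&0\\ \varphi_{i+1}&\beta_i\end{smallmatrix}\right]$ for $1\le i<n$ and last map $\left[\begin{smallmatrix}-\Sigma\alpha_1&0\\ \Sigma\varphi_1&\beta_n\end{smallmatrix}\right]$. For a collection $\mathscr N$ of $n$-$\Sigma$-sequences, $(\mathscr C,\Sigma,\mathscr N)$ is an *$n$-angulated category* if the following hold. - (N1) (a) $\mathscr N$ is closed under direct sums, direct summands and isomorphisms; (b) for every $A\in\mathscr C$ the sequence $A\xrightarrow{1}A\to0\to\cdots\to0\to\Sigma A$ is in $\mathscr N$; (c) every morphism of $\mathscr C$ is the first morphism of some sequence in $\mathscr N$. - (N2) A sequence is in $\mathscr N$ if and only if its left rotation is. - (N3) If $A_\bullet,B_\bullet\in\mathscr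 N$ and $\varphi_1\colon A_1\to B_1$, $\varphi_2\colon A_2\to B_2$ satisfy $\varphi_2\alpha_1=\beta_1\varphi_1$, then $(\varphi_1,\varphi_2)$ extends to a morphism $(\varphi_1,\varphi_2,\dots,\varphi_n)\colon A_\bullet\to B_\bullet$. - (N4) In (N3) the extension can be chosen so that its mapping cone is in $\mathscr N$. **Theorem.** Let $R$ be a commutative local ring whose maximal ideal $\mathfrak m=(p)$ is principal and nonzero and satisfies $\mathfrak m^2=0$. Let $\mathscr C$ be the category of finitely generated free $R$-modules, let $\Sigma\colon\mathscr C\to\mathscr C$ be the identity functor, and let $n\ge3$ be an integer. Let $\mathscr N$ be the collection of all $n$-$\Sigma$-sequences in $\mathscr C$ isomorphic to a direct sum $C_\bullet\oplus F(p)_\bullet$, where $C_\bullet$ is a contractible candidate $n$-angle in $\mathscr C$, $F$ is a module in $\mathscr C$, and $F(p)_\bullet$ is the $n$-$\Sigma$-sequence $F\xrightarrow{p}F\xrightarrow{p}\cdots\xrightarrow{p}F\xrightarrow{p}\Sigma F$ all of whose maps are multiplication by $p$. Then $(\mathscr C,\Sigma,\mathscr N)$ is an $n$-angulated category whenever $n$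 is even, and also when $n$ is odd and $2p=0$ in $R$. -/

import Mathlib

open CategoryTheory CategoryTheory.Limits ZeroObject

noncomputable section

universe u v w

namespace NAngle

section General

variable {C : Type u} [Category.{v} C]

/-- An `n`-`Σ`-sequence `A₁ ⟶ A₂ ⟶ ⋯ ⟶ Aₙ ⟶ Σ A₁` for `n = m + 3`, where `S` is the functor `Σ`.

The terms are indexed *from the right end*: `obj k` is the object `A_{n-k}`, so that
`obj (m + 2) = A₁`, `obj (m + 1) = A₂` and `obj 0 = Aₙ`. Accordingly `map k : obj (k+1) ⟶ obj k` is
`α_{n-k-1} : A_{n-k-1} ⟶ A_{n-k}` (so that `map (m + 1) = α₁` and `map 0 = α_{n-1}`), and `last` is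
`αₙ : Aₙ ⟶ Σ A₁`. -/
@[ext]
structure Seq (S : C ⥤ C) (m : ℕ) where
  obj : Fin (m + 3) → C
  map (k : ℕ) (h : k + 1 < m + 3) : obj ⟨k + 1, h⟩ ⟶ obj ⟨k, Nat.lt_of_succ_lt h⟩
  last : obj ⟨0, Nat.succ_pos _⟩ ⟶ S.obj (obj ⟨m + 2, Nat.lt_succ_self _⟩)

variable {S : C ⥤ C} {m : ℕ}

namespace Seq

/-- The first object `A₁`. -/
abbrev X₁ (A : Seq S m) : C := A.obj ⟨m + 2, Nat.lt_succ_self _⟩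

/-- The second object `A₂`. -/
abbrev X₂ (A : Seq S m) : C := A.obj ⟨m + 1, Nat.lt_succ_of_lt (Nat.lt_succ_self _)⟩

/-- The first morphism `α₁ : A₁ ⟶ A₂`. -/
abbrev α₁ (A : Seq S m) : A.X₁ ⟶ A.X₂ := A.map (m + 1) (Nat.lt_succ_self _)

/-- A morphism of `n`-`Σ`-sequences; the component `φ_{n-k} : A_{n-k} ⟶ B_{n-k}` is `app k`. -/
@[ext]
structure Hom (A B : Seq S m) where
  app (k : Fin (m + 3)) : A.obj k ⟶ B.obj k
  comm (k : ℕ) (h : k + 1 < m + 3) :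
    A.map k h ≫ app ⟨k, Nat.lt_of_succ_lt h⟩ = app ⟨k + 1, h⟩ ≫ B.map k h
  comm_last :
    A.last ≫ S.map (app ⟨m + 2, Nat.lt_succ_self _⟩) = app ⟨0, Nat.succ_pos _⟩ ≫ B.last

/-- The component `φ₁ : A₁ ⟶ B₁` of a morphism. -/
abbrev Hom.φ₁ {A B : Seq S m} (φ : Hom A B) : A.X₁ ⟶ B.X₁ := φ.app _

/-- The component `φ₂ : A₂ ⟶ B₂` of a morphism. -/
abbrev Hom.φ₂ {A B : Seq S m} (φ : Hom A B) : A.X₂ ⟶ B.X₂ := φ.app _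

/-- Two `n`-`Σ`-sequences are isomorphic if there is a morphism between them all of whose
components are isomorphisms. -/
def Isomorphic (A B : Seq S m) : Prop := ∃ φ : Hom A B, ∀ k, IsIso (φ.app k)

variable [Preadditive C]

/-- The left rotation `A₂ ⟶ A₃ ⟶ ⋯ ⟶ Aₙ ⟶ Σ A₁ ⟶ Σ A₂`, with last morphism `(-1)ⁿ Σ α₁`. -/
def rotate (A : Seq S m) : Seq S m where
  obj
    | ⟨0, _⟩ => S.obj A.X₁
    | ⟨k + 1, h⟩ => A.obj ⟨k, Nat.lt_of_succ_lt h⟩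
  map
    | 0, _ => A.last
    | k + 1, h => A.map k (Nat.lt_of_succ_lt h)
  last := ((-1 : ℤ) ^ (m + 3)) • S.map A.α₁

/-- A candidate `n`-angle: all compositions of two consecutive morphisms
`α₂ ∘ α₁, …, αₙ ∘ αₙ₋₁, Σ α₁ ∘ αₙ` vanish. -/
structure IsCandidate (A : Seq S m) : Prop where
  map_map (k : ℕ) (h : k + 2 < m + 3) : A.map (k + 1) h ≫ A.map k (Nat.lt_of_succ_lt h) = 0
  map_last : A.map 0 (by omega) ≫ A.last = 0
  last_map : A.last ≫ S.map A.α₁ = 0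

/-- A contracting homotopy, i.e. a homotopy from the identity morphism to the zero morphism: diagonal
morphisms `Θ_i : A_{i+1} ⟶ A_i` for `i < n` and `Θₙ : Σ A₁ ⟶ Aₙ` with
`1 = Θ_i ∘ α_i + α_{i-1} ∘ Θ_{i-1}` for `2 ≤ i ≤ n` and `1 = Σ (Θ₁ ∘ α₁) + αₙ ∘ Θₙ`. As for the
maps, `diag k` is `Θ_{n-k-1}`. -/
structure Contraction (A : Seq S m) where
  diag (k : ℕ) (h : k + 1 < m + 3) : A.obj ⟨k, Nat.lt_of_succ_lt h⟩ ⟶ A.obj ⟨k + 1, h⟩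
  diagLast : S.obj A.X₁ ⟶ A.obj ⟨0, Nat.succ_pos _⟩
  id_mid (k : ℕ) (h : k + 2 < m + 3) :
    𝟙 (A.obj ⟨k + 1, Nat.lt_of_succ_lt h⟩) =
      A.map k (Nat.lt_of_succ_lt h) ≫ diag k (Nat.lt_of_succ_lt h) + diag (k + 1) h ≫ A.map (k + 1) h
  id_zero :
    𝟙 (A.obj ⟨0, Nat.succ_pos _⟩) =
      A.last ≫ diagLast + diag 0 (by omega) ≫ A.map 0 (by omega)
  id_last :
    𝟙 (S.obj A.X₁) =
      S.map A.α₁ ≫ S.map (diag (m + 1) (Nat.lt_succ_self _)) + diagLast ≫ A.last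

/-- An `n`-`Σ`-sequence is contractible if its identity morphism is nullhomotopic. -/
def IsContractible (A : Seq S m) : Prop := Nonempty (Contraction A)

variable [HasBinaryBiproducts C]

/-- The direct sum of two `n`-`Σ`-sequences. The last morphism is `αₙ ⊕ βₙ` followed by the canonical
morphism `Σ A₁ ⊕ Σ B₁ ⟶ Σ (A₁ ⊕ B₁)`. -/
def sum (A B : Seq S m) : Seq S m where
  obj k := A.obj k ⊞ B.obj k
  map k h := biprod.map (A.map k h) (B.map k h)
  last := biprod.desc (A.last ≫ S.map biprod.inl) (B.last ≫ S.map biprod.inr)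

/-- The trivial `n`-`Σ`-sequence `X ⟶ X ⟶ 0 ⟶ ⋯ ⟶ 0 ⟶ Σ X` with first morphism the identity. -/
def trivial [HasZeroObject C] (S : C ⥤ C) (m : ℕ) (X : C) : Seq S m where
  obj k := if (k : ℕ) ≤ m then 0 else X
  map k _ :=
    if hk : k ≤ m then 0
    else eqToHom ((if_neg (fun hle : k + 1 ≤ m => hk (Nat.le_of_succ_le hle))).trans
      (if_neg hk).symm)
  last := 0

/-- The morphism `X ⊕ Y ⟶ X' ⊕ Y'` with matrix `[-a, 0; f, b]`. -/
def coneMap {X X' Y Y' : C} (a : X ⟶ X') (f : X ⟶ Y') (b : Y ⟶ Y') : X ⊞ Y ⟶ X' ⊞ Y' :=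
  biprod.desc (biprod.lift (-a) f) (biprod.lift 0 b)

/-- The mapping cone of a morphism `φ : A ⟶ B` of `n`-`Σ`-sequences:
`A₂ ⊕ B₁ ⟶ A₃ ⊕ B₂ ⟶ ⋯ ⟶ Σ A₁ ⊕ Bₙ ⟶ Σ A₂ ⊕ Σ B₁`, with the matrices
`[-α_{i+1}, 0; φ_{i+1}, β_i]` for `i < n` and, at the end, `[-Σ α₁, 0; Σ φ₁, βₙ]`, the latter followed
by the canonical morphism `Σ A₂ ⊕ Σ B₁ ⟶ Σ (A₂ ⊕ B₁)`. Except for the sign of the last map,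
the objects and maps of the `A`-part are those of the left rotation of `A`. -/
def cone {A B : Seq S m} (φ : Hom A B) : Seq S m where
  obj k := A.rotate.obj k ⊞ B.obj k
  map k h := coneMap (A.rotate.map k h) (φ.app ⟨k, Nat.lt_of_succ_lt h⟩) (B.map k h)
  last :=
    biprod.desc
      ((-S.map A.α₁) ≫ S.map (biprod.inl : A.X₂ ⟶ A.X₂ ⊞ B.X₁) +
        S.map φ.φ₁ ≫ S.map (biprod.inr : B.X₁ ⟶ A.X₂ ⊞ B.X₁))
      (B.last ≫ S.map (biprod.inr : B.X₁ ⟶ A.X₂ ⊞ B.X₁))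

end Seq

variable [Preadditive C] [HasZeroObject C] [HasBinaryBiproducts C]

/-- `(C, S, N)` is a pre-`n`-angulated category, `n = m + 3`: the additive category `C`, the
automorphism `S` of `C` and the collection `N` satisfy the axioms (N1), (N2), (N3). -/
structure IsPreNAngulated (S : C ⥤ C) (N : Set (Seq S m)) : Prop where
  /-- `S` is an automorphism of the category `C`. -/
  automorphism : ∃ T : C ⥤ C, S ⋙ T = 𝟭 C ∧ T ⋙ S = 𝟭 C
  /-- (N1)(a), isomorphisms. -/
  isomorphism_closed : ∀ A B : Seq S m, A.Isomorphic B → A ∈ N → B ∈ N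
  /-- (N1)(a), direct sums. -/
  sum_closed : ∀ A B : Seq S m, A ∈ N → B ∈ N → A.sum B ∈ N
  /-- (N1)(a), direct summands. -/
  summand_closed : ∀ A B : Seq S m, A.sum B ∈ N → A ∈ N
  /-- (N1)(b). -/
  trivial_mem : ∀ X : C, Seq.trivial S m X ∈ N
  /-- (N1)(c). -/
  exists_first : ∀ (X Y : C) (f : X ⟶ Y), ∃ A ∈ N, Arrow.mk A.α₁ = Arrow.mk f
  /-- (N2). -/
  rotate_mem_iff : ∀ A : Seq S m, A ∈ N ↔ A.rotate ∈ N
  /-- (N3). -/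
  exists_hom : ∀ A ∈ N, ∀ B ∈ N, ∀ (f₁ : A.X₁ ⟶ B.X₁) (f₂ : A.X₂ ⟶ B.X₂),
    A.α₁ ≫ f₂ = f₁ ≫ B.α₁ → ∃ φ : Seq.Hom A B, φ.φ₁ = f₁ ∧ φ.φ₂ = f₂

/-- `(C, S, N)` is an `n`-angulated category, `n = m + 3`: in addition axiom (N4) holds. -/
structure IsNAngulated (S : C ⥤ C) (N : Set (Seq S m)) : Prop extends IsPreNAngulated S N where
  /-- (N4). -/
  exists_hom_cone : ∀ A ∈ N, ∀ B ∈ N, ∀ (f₁ : A.X₁ ⟶ B.X₁) (f₂ : A.X₂ ⟶ B.X₂),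
    A.α₁ ≫ f₂ = f₁ ≫ B.α₁ →
      ∃ φ : Seq.Hom A B, φ.φ₁ = f₁ ∧ φ.φ₂ = f₂ ∧ Seq.cone φ ∈ N

end General

section Free

variable (R : Type u) [CommRing R]

/-- Finitely generated free modules, as a property of objects of `ModuleCat R`. -/
def isFGFree : ObjectProperty (ModuleCat.{u} R) :=
  fun M => Module.Finite R M ∧ Module.Free R M

/-- The category of finitely generated free `R`-modules. -/
abbrev FGFree := (isFGFree R).FullSubcategory

instance : (isFGFree R).IsClosedUnderFiniteProducts where
  isClosedUnderLimitsOfShape J _ := ⟨by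
    rintro X ⟨q⟩
    let f : J → ModuleCat.{u} R := fun j => q.diag.obj ⟨j⟩
    have e₁ : X ≅ ⨁ f :=
      IsLimit.conePointsIsoOfNatIso q.isLimit (biproduct.isLimit f) Discrete.natIsoFunctor
    have e : X ≃ₗ[R] (∀ j, f j) := (e₁ ≪≫ ModuleCat.biproductIsoPi f).toLinearEquiv
    have hfin : ∀ j, Module.Finite R (f j) := fun j => (q.prop_diag_obj ⟨j⟩).1
    have hfree : ∀ j, Module.Free R (f j) := fun j => (q.prop_diag_obj ⟨j⟩).2
    exact ⟨Module.Finite.equiv e.symm, Module.Free.of_equiv e.symm⟩⟩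

instance : HasBinaryBiproducts (FGFree R) := HasBinaryBiproducts.of_hasBinaryProducts

instance : HasZeroObject (FGFree R) := hasZeroObject_of_hasTerminal_object

variable {R}

/-- The `n`-`Σ`-sequence `F ⟶ F ⟶ ⋯ ⟶ F ⟶ Σ F` (`n = m + 3`, `Σ` the identity functor) all of whose
maps are multiplication by `p`. -/
def mulSeq (m : ℕ) (p : R) (F : FGFree R) : Seq (𝟭 (FGFree R)) m where
  obj _ := F
  map _ _ := p • 𝟙 F
  last := p • 𝟙 F

/-- The collection of all `n`-`Σ`-sequences (`n = m + 3`, `Σ` the identity functor) isomorphic to a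
direct sum of a contractible candidate `n`-angle and a sequence `mulSeq m p F`. -/
def angles (m : ℕ) (p : R) : Set (Seq (𝟭 (FGFree R)) m) :=
  {A | ∃ (K : Seq (𝟭 (FGFree R)) m) (F : FGFree R),
    K.IsCandidate ∧ K.IsContractible ∧ A.Isomorphic (K.sum (mulSeq m p F))}

end Free

end NAngle

end

/-! The collection is recognised homotopically: a candidate is an angle exactly when, up to
homotopy, it is a retract of a constant sequence F(p) (`mulAngles`). In this form closure under
isomorphisms, direct sums, direct summands and rotation is formal. Rotation needs only (-1)^n p = p,
and this is the one place where the parity of n matters.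

The ring enters through `IsUniformScalar`: p² = 0, a morphism killed by p is divisible by p, and
every morphism is von Neumann regular modulo p, by linear algebra over the residue field. As p·Hom
squares to zero, idempotents lift modulo p. Hence a homotopy retract of F(p) can be made strict over
a smaller object (`exists_strict`), and a strict one splits off with contractible complement
(`exists_isomorphic_sum`). This recovers the original description.

For (N1)(c), every f is isomorphic to 1 ⊕ pθ, and the same normal form for θ together with p² = 0
gives pθ ≅ p1 ⊕ 0. Each of 1, p1 and 0 begins an angle.

For (N3) and (N4), let A and B be strict retracts with constant parts F(p) and G(p). A commutative
square on the first two terms induces ψ : F ⟶ G, which is congruent modulo p to a regular morphism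
c, meaning c s c = c for some s. The square is then the beginning of A → F(p) → G(p) → B, induced by
c, plus a boundary (`exists_diagonals`). Adding a boundary does not change the cone up to
isomorphism. The cone of the morphism induced by c is a homotopy retract of (F ⊕ G)(p): the homotopy
given by s cancels the parts of F and G on which c is invertible, and what survives is the kernel
and cokernel of c (`Extension.nonempty_mulRetract`). -/

noncomputable section

universe u v w

namespace NAngle

/-! ### Morphisms, null-homotopic families and homotopy retracts -/

section

namespace Seq

variable {C : Type u} [Category.{v} C] {m : ℕ}

/-- The last morphism of a sequence over the identity functor. -/
def lst (A : Seq (𝟭 C) m) : A.obj ⟨0, Nat.succ_pos _⟩ ⟶ A.obj ⟨m + 2, Nat.lt_succ_self _⟩ := A.last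

/-- Extend a family from the indices below `N` to `N`. -/
theorem exists_extend_last {N : ℕ} {P : ∀ k, k < N + 1 → Sort*}
    (a : ∀ k (h : k < N), P k (Nat.lt_succ_of_lt h)) (b : P N (Nat.lt_succ_self N)) :
    ∃ f : ∀ k h, P k h, (∀ k h h', f k h' = a k h) ∧ ∀ h', f N h' = b := by
  refine ⟨fun k h => if hk : k < N then a k hk else by
    obtain rfl : k = N := by omega
    exact b, fun k h _ => dif_pos h, fun _ => ?_⟩
  simp

namespace Hom

theorem comm_lst {A B : Seq (𝟭 C) m} (φ : Hom A B) :
    A.lst ≫ φ.app ⟨m + 2, Nat.lt_succ_self _⟩ = φ.app ⟨0, Nat.succ_pos _⟩ ≫ B.lst :=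
  φ.comm_last

/-- A family commuting with all the maps is a morphism. -/
@[simps]
def mk' {A B : Seq (𝟭 C) m} (φ : ∀ k, A.obj k ⟶ B.obj k)
    (h : ∀ k (h : k + 1 < m + 3),
      A.map k h ≫ φ ⟨k, Nat.lt_of_succ_lt h⟩ = φ ⟨k + 1, h⟩ ≫ B.map k h)
    (hl : A.lst ≫ φ ⟨m + 2, Nat.lt_succ_self _⟩ = φ ⟨0, Nat.succ_pos _⟩ ≫ B.lst) : Hom A B where
  app := φ
  comm := h
  comm_last := hl

/-- The identity morphism. -/
@[simps!]
def id (A : Seq (𝟭 C) m) : Hom A A := mk' (fun _ => 𝟙 _) (fun _ _ => by rw [Category.comp_id,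
    Category.id_comp])
    (by rw [Category.comp_id, Category.id_comp])

/-- Composition of morphisms of sequences. -/
@[simps!]
def comp {A B D : Seq (𝟭 C) m} (φ : Hom A B) (ψ : Hom B D) : Hom A D :=
  mk' (fun k => φ.app k ≫ ψ.app k) (fun k h => by rw [← Category.assoc, φ.comm, Category.assoc,
    ψ.comm, Category.assoc]) (by rw [← Category.assoc, φ.comm_lst, Category.assoc,
    ψ.comm_lst, Category.assoc])

/-- The inverse of a componentwise isomorphism. -/
@[simps!]
def symm {A B : Seq (𝟭 C) m} (φ : Hom A B) [∀ k, IsIso (φ.app k)] : Hom B A :=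
  mk' (fun k => inv (φ.app k)) (fun k h => by rw [IsIso.comp_inv_eq, Category.assoc, φ.comm,
      IsIso.inv_hom_id_assoc])
    (by rw [IsIso.comp_inv_eq, Category.assoc, φ.comm_lst, IsIso.inv_hom_id_assoc])

variable [Preadditive C]

/-- The difference of two morphisms of sequences. -/
@[simps!]
def sub {A B : Seq (𝟭 C) m} (φ ψ : Hom A B) : Hom A B :=
  mk' (fun k => φ.app k - ψ.app k) (fun k h => by simp [φ.comm, ψ.comm])
    (by simp only [Preadditive.comp_sub, Preadditive.sub_comp, φ.comm_lst, ψ.comm_lst])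

/-- The sum of two morphisms of sequences. -/
@[simps!]
def add {A B : Seq (𝟭 C) m} (φ ψ : Hom A B) : Hom A B :=
  mk' (fun k => φ.app k + ψ.app k) (fun k h => by simp [φ.comm, ψ.comm])
    (by simp only [Preadditive.comp_add,
      Preadditive.add_comp, φ.comm_lst, ψ.comm_lst])

end Hom

theorem Isomorphic.symm {A B : Seq (𝟭 C) m} : A.Isomorphic B → B.Isomorphic A := by
  rintro ⟨φ, hφ⟩
  exact ⟨φ.symm, fun k => by rw [Hom.symm_app]; infer_instance⟩

section Null

variable [Preadditive C]

theorem IsCandidate.map_lst {A : Seq (𝟭 C) m} (hA : A.IsCandidate) :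
    A.map 0 (by omega) ≫ A.lst = 0 := hA.map_last

theorem IsCandidate.lst_map {A : Seq (𝟭 C) m} (hA : A.IsCandidate) :
    A.lst ≫ A.map (m + 1) (Nat.lt_succ_self _) = 0 := hA.last_map

/-- A sequence which is degreewise a retract, by morphisms, of a candidate is a candidate. -/
theorem IsCandidate.of_retract {A B : Seq (𝟭 C) m} (hB : B.IsCandidate) (i : Hom A B)
    (r : Hom B A) (h : ∀ k, i.app k ≫ r.app k = 𝟙 _) : A.IsCandidate where
  map_map k hk := by
    have : (A.map (k + 1) hk ≫ A.map k (Nat.lt_of_succ_lt hk)) ≫ 𝟙 _ = 0 := by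
      rw [← h, Category.assoc, reassoc_of% i.comm, reassoc_of% i.comm,
        reassoc_of% hB.map_map k hk]
      simp only [zero_comp, comp_zero]
    rwa [Category.comp_id] at this
  map_last := by
    have : (A.map 0 (by omega) ≫ A.lst) ≫ 𝟙 _ = 0 := by
      rw [← h, Category.assoc, reassoc_of% i.comm_lst, reassoc_of% i.comm,
        reassoc_of% hB.map_lst]
      simp only [zero_comp, comp_zero]
    rwa [Category.comp_id] at this
  last_map := by
    have : (A.lst ≫ A.map (m + 1) (Nat.lt_succ_self _)) ≫ 𝟙 _ = 0 := by
      rw [← h, Category.assoc, reassoc_of% i.comm, reassoc_of% i.comm_lst,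
        reassoc_of% hB.lst_map]
      simp only [zero_comp, comp_zero]
    rwa [Category.comp_id] at this

/-- A family `φ` of morphisms is the boundary of the diagonal family `(Θ, Λ)`. -/
structure NullBy {A B : Seq (𝟭 C) m} (φ : ∀ k, A.obj k ⟶ B.obj k)
    (Θ : ∀ k (h : k + 1 < m + 3), A.obj ⟨k, Nat.lt_of_succ_lt h⟩ ⟶ B.obj ⟨k + 1, h⟩)
    (Λ : A.obj ⟨m + 2, Nat.lt_succ_self _⟩ ⟶ B.obj ⟨0, Nat.succ_pos _⟩) : Prop where
  mid (k : ℕ) (h : k + 2 < m + 3) : φ ⟨k + 1, Nat.lt_of_succ_lt h⟩ =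
    A.map k (Nat.lt_of_succ_lt h) ≫ Θ k (Nat.lt_of_succ_lt h) + Θ (k + 1) h ≫ B.map (k + 1) h
  zero : φ ⟨0, Nat.succ_pos _⟩ = A.lst ≫ Λ + Θ 0 (by omega) ≫ B.map 0 (by omega)
  last : φ ⟨m + 2, Nat.lt_succ_self _⟩ =
    A.map (m + 1) (Nat.lt_succ_self _) ≫ Θ (m + 1) (Nat.lt_succ_self _) + Λ ≫ B.lst

/-- Nullhomotopic families of morphisms. -/
def Null {A B : Seq (𝟭 C) m} (φ : ∀ k, A.obj k ⟶ B.obj k) : Prop := ∃ Θ Λ, NullBy φ Θ Λ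

theorem isContractible_iff {A : Seq (𝟭 C) m} :
    A.IsContractible ↔ Null (fun k => 𝟙 (A.obj k)) := by
  constructor
  · rintro ⟨K⟩
    exact ⟨K.diag, K.diagLast, K.id_mid, K.id_zero, K.id_last⟩
  · rintro ⟨Θ, Λ, h⟩
    exact ⟨⟨Θ, Λ, h.mid, h.zero, h.last⟩⟩

variable {A B D : Seq (𝟭 C) m}

theorem Null.add {φ ψ : ∀ k, A.obj k ⟶ B.obj k} :
    Null φ → Null ψ → Null (fun k => φ k + ψ k) := by
  rintro ⟨Θ, Λ, h⟩ ⟨Θ', Λ', h'⟩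
  refine ⟨fun k h => Θ k h + Θ' k h, Λ + Λ', fun k hk => ?_, ?_, ?_⟩
  · simp only [h.mid k hk, h'.mid k hk, Preadditive.comp_add, Preadditive.add_comp]; abel
  · simp only [h.zero, h'.zero, Preadditive.comp_add, Preadditive.add_comp]; abel
  · simp only [h.last, h'.last, Preadditive.comp_add, Preadditive.add_comp]; abel

/-- Null families absorb morphisms from either side. Only ψ has to commute with the maps of the
sequences, since it must be moved past them in the boundary. -/
theorem NullBy.comp_left {φ : ∀ k, B.obj k ⟶ D.obj k} {Θ Λ} (h : NullBy φ Θ Λ) (ψ : Hom A B) :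
    NullBy (fun k => ψ.app k ≫ φ k) (fun k _ => ψ.app _ ≫ Θ k _) (ψ.app _ ≫ Λ) where
  mid k hk := by rw [h.mid k hk, Preadditive.comp_add, ← reassoc_of% ψ.comm, Category.assoc]
  zero := by rw [h.zero, Preadditive.comp_add, ← reassoc_of% ψ.comm_lst, Category.assoc]
  last := by rw [h.last, Preadditive.comp_add, ← reassoc_of% ψ.comm, Category.assoc]

theorem NullBy.comp_right {φ : ∀ k, A.obj k ⟶ B.obj k} {Θ Λ} (h : NullBy φ Θ Λ) (ψ : Hom B D) :
    NullBy (fun k => φ k ≫ ψ.app k) (fun k _ => Θ k _ ≫ ψ.app _) (Λ ≫ ψ.app _) where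
  mid k hk := by simp only [h.mid k hk, Preadditive.add_comp, Category.assoc, ψ.comm]
  zero := by simp only [h.zero, Preadditive.add_comp, Category.assoc, ψ.comm]
  last := by simp only [h.last, Preadditive.add_comp, Category.assoc, ψ.comm_lst]

theorem Null.comp_left {φ : ∀ k, B.obj k ⟶ D.obj k} (h : Null φ) (ψ : Hom A B) :
    Null (fun k => ψ.app k ≫ φ k) := by
  obtain ⟨Θ, Λ, h⟩ := h
  exact ⟨_, _, h.comp_left ψ⟩

theorem Null.comp_right {φ : ∀ k, A.obj k ⟶ B.obj k} (h : Null φ) (ψ : Hom B D) :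
    Null (fun k => φ k ≫ ψ.app k) := by
  obtain ⟨Θ, Λ, h⟩ := h
  exact ⟨_, _, h.comp_right ψ⟩

end Null

section MulRetract

variable {R : Type w} [CommRing R] [Preadditive C] [Linear R C]

/-- Morphisms between `A` and the constant sequence on `F` with all maps multiplication by `p`,
in both directions. -/
structure MulPair (p : R) (A : Seq (𝟭 C) m) (F : C) where
  toMul (k : Fin (m + 3)) : A.obj k ⟶ F
  ofMul (k : Fin (m + 3)) : F ⟶ A.obj k
  map_to (k : ℕ) (h : k + 1 < m + 3) :
    A.map k h ≫ toMul ⟨k, Nat.lt_of_succ_lt h⟩ = p • toMul ⟨k + 1, h⟩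
  lst_to : A.lst ≫ toMul ⟨m + 2, Nat.lt_succ_self _⟩ = p • toMul ⟨0, Nat.succ_pos _⟩
  ofMul_map (k : ℕ) (h : k + 1 < m + 3) :
    ofMul ⟨k + 1, h⟩ ≫ A.map k h = p • ofMul ⟨k, Nat.lt_of_succ_lt h⟩
  ofMul_lst : ofMul ⟨0, Nat.succ_pos _⟩ ≫ A.lst = p • ofMul ⟨m + 2, Nat.lt_succ_self _⟩

/-- Morphisms between `A` and the constant sequence on `F` with all maps multiplication by `p`
which exhibit `A` as a retract of that sequence up to homotopy. -/
structure MulRetract (p : R) (A : Seq (𝟭 C) m) (F : C) extends MulPair p A F where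
  null : Null (fun k => 𝟙 (A.obj k) - toMul k ≫ ofMul k)

namespace MulPair

variable {p : R} {A : Seq (𝟭 C) m} {F : C}

theorem map_to_assoc (M : MulPair p A F) (k : ℕ) (h : k + 1 < m + 3) {X : C} (x : F ⟶ X) :
    A.map k h ≫ M.toMul ⟨k, Nat.lt_of_succ_lt h⟩ ≫ x = (p • M.toMul ⟨k + 1, h⟩) ≫ x := by
  rw [← Category.assoc, M.map_to]

theorem lst_to_assoc (M : MulPair p A F) {X : C} (x : F ⟶ X) :
    A.lst ≫ M.toMul ⟨m + 2, Nat.lt_succ_self _⟩ ≫ x = (p • M.toMul ⟨0, Nat.succ_pos _⟩) ≫ x := by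
  rw [← Category.assoc, M.lst_to]

theorem ofMul_map_assoc (M : MulPair p A F) (k : ℕ) (h : k + 1 < m + 3) {X : C}
    (x : A.obj ⟨k, Nat.lt_of_succ_lt h⟩ ⟶ X) :
    M.ofMul ⟨k + 1, h⟩ ≫ A.map k h ≫ x = (p • M.ofMul ⟨k, Nat.lt_of_succ_lt h⟩) ≫ x := by
  rw [← Category.assoc, M.ofMul_map]

theorem ofMul_lst_assoc (M : MulPair p A F) {X : C}
    (x : A.obj ⟨m + 2, Nat.lt_succ_self _⟩ ⟶ X) :
    M.ofMul ⟨0, Nat.succ_pos _⟩ ≫ A.lst ≫ x =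
      (p • M.ofMul ⟨m + 2, Nat.lt_succ_self _⟩) ≫ x := by
  rw [← Category.assoc, M.ofMul_lst]

/-- The endomorphism of `A` which factors through the constant sequence. -/
@[simps!]
def proj (M : MulPair p A F) : Hom A A :=
  Hom.mk' (fun k => M.toMul k ≫ M.ofMul k)
    (fun k h => by simp [M.map_to_assoc, M.ofMul_map])
    (by simp only [M.lst_to_assoc, Category.assoc, M.ofMul_lst, Linear.smul_comp, Linear.comp_smul])

end MulPair

namespace MulRetract

variable {p : R} {A B : Seq (𝟭 C) m} {F : C}

/-- Homotopy retracts pass to strict retracts. -/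
def ofRetract (M : MulRetract p B F) (i : Hom A B) (r : Hom B A)
    (h : ∀ k, i.app k ≫ r.app k = 𝟙 _) : MulRetract p A F where
  toMul k := i.app k ≫ M.toMul k
  ofMul k := M.ofMul k ≫ r.app k
  map_to k hk := by rw [reassoc_of% i.comm, M.map_to]; simp
  lst_to := by rw [reassoc_of% i.comm_lst, M.lst_to, Linear.comp_smul]
  ofMul_map k hk := by rw [Category.assoc, ← r.comm, M.ofMul_map_assoc]; simp
  ofMul_lst := by rw [Category.assoc, ← r.comm_lst, M.ofMul_lst_assoc]; simp
  null := by
    convert (M.null.comp_left i).comp_right r using 2 with k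
    simp [h]

theorem exists_ofIso (M : MulRetract p B F) (hAB : A.Isomorphic B) :
    ∃ M' : MulRetract p A F, (∀ k, M.ofMul k ≫ M.toMul k = 𝟙 _) → ∀ k, M'.ofMul k ≫ M'.toMul k = 𝟙
        _ := by
  obtain ⟨φ, hφ⟩ := hAB
  exact ⟨M.ofRetract φ φ.symm (by simp), fun h k => by simp [ofRetract, h]⟩

/-- Contractible sequences are homotopy retracts of any constant sequence. -/
def ofContractible (hA : A.IsContractible) (F : C) : MulRetract p A F where
  toMul _ := 0
  ofMul _ := 0
  map_to := by simp
  lst_to := by rw [comp_zero, smul_zero]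
  ofMul_map := by simp
  ofMul_lst := by rw [zero_comp, smul_zero]
  null := by simpa using isContractible_iff.1 hA

end MulRetract

end MulRetract

end Seq

end

/-! ### Direct sums, constant sequences and splitting off strict retracts -/

section

namespace Seq

section Sum

variable {C : Type u} [Category.{v} C] {m : ℕ} [Preadditive C] [HasBinaryBiproducts C]

/-- The inclusion of the first summand. -/
def sumInl (A B : Seq (𝟭 C) m) : Hom A (A.sum B) :=
  Hom.mk' (fun _ => biprod.inl) (fun _ _ => (biprod.inl_map _ _).symm)
    (biprod.inl_desc _ _).symm

/-- The inclusion of the second summand. -/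
def sumInr (A B : Seq (𝟭 C) m) : Hom B (A.sum B) :=
  Hom.mk' (fun _ => biprod.inr) (fun _ _ => (biprod.inr_map _ _).symm)
    (biprod.inr_desc _ _).symm

/-- The projection to the first summand. -/
def sumFst (A B : Seq (𝟭 C) m) : Hom (A.sum B) A :=
  Hom.mk' (fun _ => biprod.fst) (fun _ _ => biprod.map_fst _ _) (by
    have : biprod.desc (A.lst ≫ biprod.inl) (B.lst ≫ biprod.inr) ≫ biprod.fst =
      biprod.fst ≫ A.lst := by
      apply biprod.hom_ext'
      · rw [biprod.inl_desc_assoc, Category.assoc, biprod.inl_fst, biprod.inl_fst_assoc,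
          Category.comp_id]
      · rw [biprod.inr_desc_assoc, Category.assoc, biprod.inr_fst, biprod.inr_fst_assoc,
          comp_zero, zero_comp]
    exact this)

/-- The projection to the second summand. -/
def sumSnd (A B : Seq (𝟭 C) m) : Hom (A.sum B) B :=
  Hom.mk' (fun _ => biprod.snd) (fun _ _ => biprod.map_snd _ _) (by
    have : biprod.desc (A.lst ≫ biprod.inl) (B.lst ≫ biprod.inr) ≫ biprod.snd =
      biprod.snd ≫ B.lst := by
      apply biprod.hom_ext'
      · rw [biprod.inl_desc_assoc, Category.assoc, biprod.inl_snd, biprod.inl_snd_assoc,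
          comp_zero, zero_comp]
      · rw [biprod.inr_desc_assoc, Category.assoc, biprod.inr_snd, biprod.inr_snd_assoc,
          Category.comp_id]
    exact this)

section

variable (A B : Seq (𝟭 C) m) (k : Fin (m + 3))

@[simp]
theorem sumInl_sumFst : (sumInl A B).app k ≫ (sumFst A B).app k = 𝟙 _ := biprod.inl_fst

@[simp]
theorem sumInl_sumSnd : (sumInl A B).app k ≫ (sumSnd A B).app k = 0 := biprod.inl_snd

@[simp]
theorem sumInr_sumFst : (sumInr A B).app k ≫ (sumFst A B).app k = 0 := biprod.inr_fst

@[simp]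
theorem sumInl_sumFst_assoc {X : C} (x : A.obj k ⟶ X) :
    (sumInl A B).app k ≫ (sumFst A B).app k ≫ x = x := biprod.inl_fst_assoc x

@[simp]
theorem sumInl_sumSnd_assoc {X : C} (x : B.obj k ⟶ X) :
    (sumInl A B).app k ≫ (sumSnd A B).app k ≫ x = 0 := by
  rw [← Category.assoc, sumInl_sumSnd, zero_comp]

@[simp]
theorem sumInr_sumFst_assoc {X : C} (x : A.obj k ⟶ X) :
    (sumInr A B).app k ≫ (sumFst A B).app k ≫ x = 0 := by
  rw [← Category.assoc, sumInr_sumFst, zero_comp]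

@[simp]
theorem sumInr_sumSnd_assoc {X : C} (x : B.obj k ⟶ X) :
    (sumInr A B).app k ≫ (sumSnd A B).app k ≫ x = x := biprod.inr_snd_assoc x

theorem sum_total : (sumFst A B).app k ≫ (sumInl A B).app k +
    (sumSnd A B).app k ≫ (sumInr A B).app k = 𝟙 _ := biprod.total

variable {A B k}

theorem sum_ext_left {X : C} {f g : (A.sum B).obj k ⟶ X}
    (h : (sumInl A B).app k ≫ f = (sumInl A B).app k ≫ g)
    (h' : (sumInr A B).app k ≫ f = (sumInr A B).app k ≫ g) : f = g :=
  biprod.hom_ext' f g h h'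

end

theorem IsCandidate.sum {A B : Seq (𝟭 C) m} (hA : A.IsCandidate) (hB : B.IsCandidate) :
    (A.sum B).IsCandidate where
  map_map k h := by
    apply sum_ext_left
    · rw [← reassoc_of% (sumInl A B).comm, ← (sumInl A B).comm, reassoc_of% hA.map_map, zero_comp,
        comp_zero]
    · rw [← reassoc_of% (sumInr A B).comm, ← (sumInr A B).comm, reassoc_of% hB.map_map, zero_comp,
        comp_zero]
  map_last := by
    change _ ≫ (A.sum B).lst = 0
    apply sum_ext_left
    · rw [← reassoc_of% (sumInl A B).comm, ← (sumInl A B).comm_lst, reassoc_of% hA.map_lst,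
        zero_comp, comp_zero]
    · rw [← reassoc_of% (sumInr A B).comm, ← (sumInr A B).comm_lst, reassoc_of% hB.map_lst,
        zero_comp, comp_zero]
  last_map := by
    change (A.sum B).lst ≫ (A.sum B).map (m + 1) (Nat.lt_succ_self _) = 0
    apply sum_ext_left
    · rw [← reassoc_of% (sumInl A B).comm_lst, ← (sumInl A B).comm, reassoc_of% hA.lst_map,
        zero_comp, comp_zero]
    · rw [← reassoc_of% (sumInr A B).comm_lst, ← (sumInr A B).comm, reassoc_of% hB.lst_map,
        zero_comp, comp_zero]

end Sum

section Const

variable {C : Type u} [Category.{v} C] {m : ℕ} [Preadditive C]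
  {R : Type w} [CommRing R] [Linear R C]

/-- The constant sequence all of whose maps are multiplication by `p`. -/
def const (m : ℕ) (p : R) (F : C) : Seq (𝟭 C) m where
  obj _ := F
  map _ _ := p • 𝟙 F
  last := p • 𝟙 F

/-- The constant sequence is a retract of itself. -/
def MulRetract.refl (m : ℕ) (p : R) (F : C) : MulRetract p (const m p F) F where
  toMul _ := 𝟙 F
  ofMul _ := 𝟙 F
  map_to k h := Category.comp_id (p • 𝟙 F)
  lst_to := Category.comp_id (p • 𝟙 F)
  ofMul_map k h := Category.id_comp (p • 𝟙 F)
  ofMul_lst := Category.id_comp (p • 𝟙 F)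
  null := ⟨fun _ _ => (0 : F ⟶ F), (0 : F ⟶ F), by
    have : 𝟙 F - 𝟙 F ≫ 𝟙 F = (p • 𝟙 F) ≫ (0 : F ⟶ F) + (0 : F ⟶ F) ≫ (p • 𝟙 F) := by simp
    exact ⟨fun _ _ => this, this, this⟩⟩

theorem isCandidate_const {p : R} (hp : p * p = 0) (F : C) : (const m p F).IsCandidate := by
  have : (p • 𝟙 F) ≫ (p • 𝟙 F) = 0 := by simp [smul_smul, hp]
  exact ⟨fun _ _ => this, this, this⟩

namespace MulPair

variable {p : R} {A : Seq (𝟭 C) m} {F : C}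

/-- The morphism from `A` to the constant sequence. -/
def toConst (M : MulPair p A F) : Hom A (const m p F) :=
  Hom.mk' M.toMul
    (fun k h => by
      have : A.map k h ≫ M.toMul ⟨k, Nat.lt_of_succ_lt h⟩ = M.toMul ⟨k + 1, h⟩ ≫ (p • 𝟙 F) := by
        simp [M.map_to]
      exact this)
    (by
      have : A.lst ≫ M.toMul _ = M.toMul ⟨0, Nat.succ_pos _⟩ ≫ (p • 𝟙 F) := by
        rw [M.lst_to, Linear.comp_smul, Category.comp_id]
      exact this)

/-- The morphism from the constant sequence to `A`. -/
def ofConst (M : MulPair p A F) : Hom (const m p F) A :=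
  Hom.mk' M.ofMul
    (fun k h => by
      have : (p • 𝟙 F) ≫ M.ofMul ⟨k, Nat.lt_of_succ_lt h⟩ = M.ofMul ⟨k + 1, h⟩ ≫ A.map k h := by
        simp [M.ofMul_map]
      exact this)
    (by
      have : (p • 𝟙 F) ≫ M.ofMul _ = M.ofMul ⟨0, Nat.succ_pos _⟩ ≫ A.lst := by
        rw [M.ofMul_lst, Linear.smul_comp, Category.id_comp]
      exact this)

end MulPair

namespace MulRetract

variable {p : R} {A B : Seq (𝟭 C) m} {F G : C}

variable [HasBinaryBiproducts C]

/-- The direct sum of homotopy retracts. -/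
def sum (M : MulRetract p A F) (N : MulRetract p B G) : MulRetract p (A.sum B) (F ⊞ G) where
  toMul k := (sumFst A B).app k ≫ M.toMul k ≫ biprod.inl +
    (sumSnd A B).app k ≫ N.toMul k ≫ biprod.inr
  ofMul k := biprod.fst ≫ M.ofMul k ≫ (sumInl A B).app k +
    biprod.snd ≫ N.ofMul k ≫ (sumInr A B).app k
  map_to k h := by
    simp only [Preadditive.comp_add, reassoc_of% (sumFst A B).comm, reassoc_of% (sumSnd A B).comm,
      M.map_to_assoc, N.map_to_assoc, Linear.smul_comp, Linear.comp_smul, smul_add]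
  lst_to := by
    simp only [Preadditive.comp_add, reassoc_of% (sumFst A B).comm_lst,
      reassoc_of% (sumSnd A B).comm_lst,
      M.lst_to_assoc, N.lst_to_assoc, Linear.smul_comp, Linear.comp_smul, smul_add]
  ofMul_map k h := by
    simp only [Preadditive.add_comp, Category.assoc, ← (sumInl A B).comm, ← (sumInr A B).comm,
      M.ofMul_map_assoc, N.ofMul_map_assoc, Linear.smul_comp, Linear.comp_smul, smul_add]
  ofMul_lst := by
    simp only [Preadditive.add_comp, Category.assoc, ← (sumInl A B).comm_lst,
      ← (sumInr A B).comm_lst,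
      M.ofMul_lst_assoc, N.ofMul_lst_assoc, Linear.smul_comp, Linear.comp_smul, smul_add]
  null := by
    convert ((M.null.comp_left (sumFst A B)).comp_right (sumInl A B)).add
      ((N.null.comp_left (sumSnd A B)).comp_right (sumInr A B)) using 2 with k
    rw [← sum_total]
    simp
    abel

/-- The projection of `K ⊕ B` to `B` for contractible `K`. -/
def contractibleSum {K : Seq (𝟭 C) m} (hK : K.IsContractible) (N : MulRetract p B G) :
    MulRetract p (K.sum B) G where
  toMul k := (sumSnd K B).app k ≫ N.toMul k
  ofMul k := N.ofMul k ≫ (sumInr K B).app k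
  map_to k h := by
    rw [reassoc_of% (sumSnd K B).comm, N.map_to, Linear.comp_smul]
  lst_to := by
    rw [reassoc_of% (sumSnd K B).comm_lst, N.lst_to, Linear.comp_smul]
  ofMul_map k h := by
    rw [Category.assoc, ← (sumInr K B).comm, N.ofMul_map_assoc, Linear.smul_comp]
  ofMul_lst := by
    rw [Category.assoc, ← (sumInr K B).comm_lst, N.ofMul_lst_assoc, Linear.smul_comp]
  null := by
    convert (((isContractible_iff.1 hK).comp_left (sumFst K B)).comp_right (sumInl K B)).add
      ((N.null.comp_left (sumSnd K B)).comp_right (sumInr K B)) using 2 with k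
    rw [← sum_total]
    simp
    abel

/-- A strict homotopy retract splits off, with contractible complement. -/
theorem exists_isomorphic_sum [IsIdempotentComplete C] (hA : A.IsCandidate)
    (M : MulRetract p A F) (hM : ∀ k, M.ofMul k ≫ M.toMul k = 𝟙 _) :
    ∃ K : Seq (𝟭 C) m, K.IsCandidate ∧ K.IsContractible ∧ A.Isomorphic (K.sum (const m p F)) := by
  -- Strictness makes `M.proj` idempotent, hence also its complement q. As q is a morphism,
  -- splitting it degree by degree yields a sequence K, and q is null because M is a homotopy
  -- retract.
  let q : Hom A A := (Hom.id A).sub M.proj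
  have hq k : q.app k = 𝟙 _ - M.toMul k ≫ M.ofMul k := rfl
  have hqt k : q.app k ≫ M.toMul k = 0 := by simp [hq, hM]
  have hoq k : M.ofMul k ≫ q.app k = 0 := by simp [hq, reassoc_of% hM]
  have hqq k : q.app k ≫ q.app k = q.app k := by
    calc
      _ = (𝟙 _ - M.toMul k ≫ M.ofMul k) ≫ q.app k := by rw [hq]
      _ = _ := by rw [Preadditive.sub_comp, Category.assoc, hoq, comp_zero, sub_zero,
        Category.id_comp]
  choose Y i r hir hri using fun k => IsIdempotentComplete.idempotents_split _ (q.app k) (hqq k)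
  let K : Seq (𝟭 C) m :=
    { obj := Y
      map k h := i _ ≫ A.map k h ≫ r _
      last := i _ ≫ A.lst ≫ r _ }
  have hiq k : i k ≫ q.app k = i k := by rw [← hri, reassoc_of% hir]
  have hqr k : q.app k ≫ r k = r k := by rw [← hri, Category.assoc, hir, Category.comp_id]
  let I : Hom K A := Hom.mk' i
    (fun k h => by
      change (i _ ≫ A.map k h ≫ r _) ≫ i _ = _
      simp only [Category.assoc, hri, q.comm]
      rw [reassoc_of% hiq])
    (by
      change (i _ ≫ A.lst ≫ r _) ≫ i _ = _
      simp only [Category.assoc, hri, q.comm_lst]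
      rw [reassoc_of% hiq])
  let P : Hom A K := Hom.mk' r
    (fun k h => by
      change _ = r _ ≫ (i _ ≫ A.map k h ≫ r _)
      rw [reassoc_of% hri, ← reassoc_of% q.comm, hqr])
    (by
      change _ = r _ ≫ (i _ ≫ A.lst ≫ r _)
      rw [reassoc_of% hri, ← reassoc_of% q.comm_lst, hqr])
  have hIP k : I.app k ≫ P.app k = 𝟙 _ := hir k
  have hIT k : I.app k ≫ M.toConst.app k = 0 := by
    change i k ≫ M.toMul k = 0
    rw [← hiq, Category.assoc, hqt, comp_zero]
  have hOP k : M.ofConst.app k ≫ P.app k = 0 := by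
    change M.ofMul k ≫ r k = 0
    rw [← hqr, reassoc_of% hoq, zero_comp]
  have hOT k : M.ofConst.app k ≫ M.toConst.app k = 𝟙 _ := hM k
  have hPI k : P.app k ≫ I.app k + M.toConst.app k ≫ M.ofConst.app k = 𝟙 _ := by
    change r k ≫ i k + M.toMul k ≫ M.ofMul k = 𝟙 _
    rw [hri, hq, sub_add_cancel]
  refine ⟨K, hA.of_retract I P hir, ?_, ?_⟩
  · rw [isContractible_iff]
    convert (M.null.comp_left I).comp_right P using 2 with k
    change 𝟙 _ = (i k ≫ q.app k) ≫ r k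
    rw [hiq, hir]
  · refine ⟨(P.comp (sumInl _ _)).add (M.toConst.comp (sumInr _ _)), fun k =>
      ⟨(((sumFst _ _).comp I).add ((sumSnd _ _).comp M.ofConst)).app k, ?_, ?_⟩⟩
    · simp [hPI]
    · apply sum_ext_left
      · simp [reassoc_of% hIP, reassoc_of% hIT]
      · simp [reassoc_of% hOP, reassoc_of% hOT]

end MulRetract

end Const

end Seq

end

/-! ### Congruence modulo p and strictification of homotopy retracts -/

section

/-- Lifting of idempotents along a square zero ideal. -/
theorem exists_idempotent_of_sq {E : Type*} [Ring E] (w : E)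
    (h : (w * w - w) * (w * w - w) = 0) :
    ∃ e, e * e = e ∧ e = w + (w * w - w) * (1 - 2 * w) := by
  refine ⟨_, sub_eq_zero.1 ?_, rfl⟩
  -- This e is 3w² - 2w³, the usual lifting polynomial, for which e² - e is a multiple of (w² - w)².
  have : ∀ e, e = w + (w * w - w) * (1 - 2 * w) →
      e * e - e = (4 * (w * w) - 4 * w - 3) * ((w * w - w) * (w * w - w)) := by
    rintro _ rfl
    noncomm_ring
  rw [this _ rfl, h, mul_zero]

variable {C : Type u} [Category.{v} C] [Preadditive C] {R : Type w} [CommRing R] [Linear R C]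

variable (C) in
/-- The scalar `p` squares to zero on `C`, has no further annihilators, and every morphism is von
Neumann regular modulo `p`. -/
structure IsUniformScalar (p : R) : Prop where
  mul_self : p * p = 0
  exists_eq_smul {X Y : C} (z : X ⟶ Y) : p • z = 0 → ∃ y, z = p • y
  exists_regular {X Y : C} (f : X ⟶ Y) : ∃ (s : Y ⟶ X) (t : X ⟶ Y), f ≫ s ≫ f = f + p • t

namespace IsUniformScalar

variable {p : R}

theorem smul_smul_eq_zero (hp : IsUniformScalar C p) {X Y : C} (z : X ⟶ Y) : p • p • z = 0 := by
  rw [smul_smul, hp.mul_self, zero_smul]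

/-- Together with p² = 0 this makes `p • x = p • y` equivalent to congruence of x and y modulo p,
and congruences are written in that form from here on. -/
theorem exists_eq_add_smul (hp : IsUniformScalar C p) {X Y : C} {x y : X ⟶ Y} (h : p • x = p • y) :
    ∃ z, x = y + p • z := by
  obtain ⟨z, hz⟩ := hp.exists_eq_smul (x - y) (by rw [smul_sub, h, sub_self])
  exact ⟨z, by rw [← hz]; abel⟩

end IsUniformScalar

theorem smul_comp_congr {p : R} {X Y Z : C} {a b : X ⟶ Y} {c d : Y ⟶ Z} (h : p • a = p • b)
    (h' : p • c = p • d) : p • (a ≫ c) = p • (b ≫ d) := by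
  rw [← Linear.smul_comp, h, Linear.smul_comp, ← Linear.comp_smul, h', Linear.comp_smul]

/-- The multiples of p in the endomorphism ring form a square zero ideal, so an idempotent modulo p
lifts without changing its class. -/
theorem IsUniformScalar.exists_idempotent {p : R} (hp : IsUniformScalar C p) {F : C} (w t : F ⟶ F)
    (h : w ≫ w = w + p • t) : ∃ e : F ⟶ F, e ≫ e = e ∧ p • e = p • w := by
  have hn : (show End F from w) * (show End F from w) - (show End F from w) = p • t := by
    change w ≫ w - w = p • t
    rw [h]; abel
  obtain ⟨e, he, he'⟩ := exists_idempotent_of_sq (show End F from w) (by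
    rw [hn]
    change (p • t) ≫ (p • t) = 0
    rw [Linear.smul_comp, Linear.comp_smul, hp.smul_smul_eq_zero])
  refine ⟨e, he, ?_⟩
  rw [hn] at he'
  rw [he']
  change p • (w + (show F ⟶ F from _) ≫ (p • t)) = p • w
  rw [Linear.comp_smul, smul_add, hp.smul_smul_eq_zero, add_zero]

namespace Seq.MulRetract

variable {m : ℕ} {p : R} {A : Seq (𝟭 C) m} {F : C}

/-- Inserting the map of A between `ofMul` in degree k + 1 and `toMul` in degree k and absorbing it
on either side gives p times the composite in both degrees. So the composite is independent of the
degree modulo p. -/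
theorem smul_ofMul_comp_toMul (M : MulPair p A F) (k : Fin (m + 3)) :
    p • (M.ofMul k ≫ M.toMul k) = p • (M.ofMul ⟨0, Nat.succ_pos _⟩ ≫ M.toMul ⟨0, Nat.succ_pos _⟩)
        := by
  obtain ⟨k, hk⟩ := k
  induction k with
  | zero => rfl
  | succ k ih =>
    rw [← ih (by omega), ← Linear.comp_smul, ← M.map_to k hk, M.ofMul_map_assoc, Linear.smul_comp]

/-- Sandwich the null-homotopy of 1 - `toMul` ≫ `ofMul` between `ofMul` and `toMul`: each boundary
term has a map of A at one end, which is absorbed there as a factor p. Hence the composite on F is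
idempotent modulo p. -/
theorem exists_ofMul_comp_toMul_sq (M : MulRetract p A F) :
    ∃ t, (M.ofMul ⟨0, Nat.succ_pos _⟩ ≫ M.toMul ⟨0, Nat.succ_pos _⟩) ≫ (M.ofMul ⟨0, Nat.succ_pos _⟩
        ≫ M.toMul ⟨0, Nat.succ_pos _⟩) = M.ofMul ⟨0, Nat.succ_pos _⟩ ≫ M.toMul ⟨0, Nat.succ_pos _⟩
        + p • t := by
  obtain ⟨Θ, Λ, h⟩ := M.null
  have h0 : 𝟙 (A.obj ⟨0, Nat.succ_pos _⟩) - M.toMul ⟨0, Nat.succ_pos _⟩ ≫ M.ofMul ⟨0, Nat.succ_pos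
      _⟩ = A.lst ≫ Λ + Θ 0 (by omega) ≫ A.map 0 (by omega) :=
    h.zero
  have h1 : M.ofMul ⟨0, Nat.succ_pos _⟩ ≫ (𝟙 (A.obj ⟨0, Nat.succ_pos _⟩) - M.toMul ⟨0, Nat.succ_pos
      _⟩ ≫ M.ofMul ⟨0, Nat.succ_pos _⟩) ≫ M.toMul ⟨0, Nat.succ_pos _⟩ =
      M.ofMul ⟨0, Nat.succ_pos _⟩ ≫ (A.lst ≫ Λ + Θ 0 (by omega) ≫ A.map 0 (by omega)) ≫ M.toMul ⟨0,
          Nat.succ_pos _⟩ := by rw [h0]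
  have h2 : M.ofMul ⟨0, Nat.succ_pos _⟩ ≫ A.lst ≫ Λ ≫ M.toMul ⟨0, Nat.succ_pos _⟩ = p • (M.ofMul ⟨m
      + 2, by omega⟩ ≫ Λ ≫ M.toMul ⟨0, Nat.succ_pos _⟩) := by
    rw [M.ofMul_lst_assoc, Linear.smul_comp]
  have h3 : A.map 0 (by omega) ≫ M.toMul ⟨0, Nat.succ_pos _⟩ = p • M.toMul _ := M.map_to 0 (by
      omega)
  refine ⟨-(M.ofMul ⟨m + 2, by omega⟩ ≫ Λ ≫ M.toMul ⟨0, Nat.succ_pos _⟩ + M.ofMul ⟨0, Nat.succ_pos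
      _⟩ ≫ Θ 0 (by omega) ≫ M.toMul _), ?_⟩
  simp only [Preadditive.sub_comp, Preadditive.comp_sub, Preadditive.add_comp, Preadditive.comp_add,
    Category.assoc, Category.id_comp, h2, h3, Linear.comp_smul] at h1
  rw [smul_neg, smul_add, ← h1]
  simp only [Category.assoc]
  abel

/-- A homotopy retract of a constant sequence is homotopy equivalent to a constant sequence which is
a strict retract of it. -/
theorem exists_strict [IsIdempotentComplete C] (hp : IsUniformScalar C p) (M : MulRetract p A F) :
    ∃ (F' : C) (M' : MulRetract p A F'), ∀ k, M'.ofMul k ≫ M'.toMul k = 𝟙 _ := by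
  obtain ⟨t, ht⟩ := M.exists_ofMul_comp_toMul_sq
  obtain ⟨e₀, he, hew⟩ := hp.exists_idempotent _ t ht
  obtain ⟨F', i, r, hir, hri⟩ := IsIdempotentComplete.idempotents_split _ e₀ he
  have hw (k) : p • (M.ofMul k ≫ M.toMul k) = p • e₀ := by rw [hew, smul_ofMul_comp_toMul]
  have hv (k) : p • (i ≫ (M.ofMul k ≫ M.toMul k) ≫ r) = p • 𝟙 F' := by
    rw [smul_comp_congr rfl (smul_comp_congr (hw k) rfl), ← hri]
    simp [hir]
  -- The composite on F' is 1 + pz, so 2 - (1 + pz) = 1 - pz is its exact inverse. Being congruent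
  -- to 1, the correction by u disappears in every equation multiplied by p, so compatibility with
  -- the maps survives.
  let u (k) : F' ⟶ F' := 2 • 𝟙 F' - i ≫ (M.ofMul k ≫ M.toMul k) ≫ r
  have hu (k) : p • u k = p • 𝟙 F' := by
    simp only [u, smul_sub, hv]
    rw [two_smul, smul_add, add_sub_cancel_right]
  have huv (k) : u k ≫ i ≫ (M.ofMul k ≫ M.toMul k) ≫ r = 𝟙 F' := by
    obtain ⟨z, hz⟩ := hp.exists_eq_add_smul (hv k)
    simp only [u]
    rw [hz]
    simp [two_smul, Preadditive.sub_comp, Preadditive.comp_add,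
      smul_sub, hp.smul_smul_eq_zero]
  let M' : MulPair p A F' :=
    { toMul k := M.toMul k ≫ r
      ofMul k := u k ≫ i ≫ M.ofMul k
      map_to k h := by rw [M.map_to_assoc, Linear.smul_comp]
      lst_to := by rw [M.lst_to_assoc, Linear.smul_comp]
      ofMul_map k h := by
        simp only [Category.assoc, M.ofMul_map, Linear.comp_smul]
        rw [smul_comp_congr (hu _) rfl, smul_comp_congr (hu _) rfl]
      ofMul_lst := by
        simp only [Category.assoc, M.ofMul_lst, Linear.comp_smul]
        rw [smul_comp_congr (hu _) rfl, smul_comp_congr (hu _) rfl] }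
  have hM' k : M'.ofMul k ≫ M'.toMul k = 𝟙 F' := by
    rw [← huv k]
    simp [M']
  let e : Hom A A := (Hom.id A).sub M'.proj
  have he1 k : e.app k = 𝟙 _ - M'.toMul k ≫ M'.ofMul k := rfl
  have hee k : e.app k ≫ e.app k = e.app k := by
    have : e.app k ≫ M'.toMul k = 0 := by simp [he1, hM']
    calc
      _ = e.app k ≫ (𝟙 _ - M'.toMul k ≫ M'.ofMul k) := by rw [← he1]
      _ = _ := by rw [Preadditive.comp_sub, reassoc_of% this, zero_comp, sub_zero,
        Category.comp_id]
  -- e must be shown null, whereas the old retract only makes e - x null. The old retract carries no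
  -- more than the new one modulo p, so `ofMul` ≫ e ≫ `toMul` is divisible by p. Since x³ contains
  -- this factor twice, x³ = 0, and e = (e - x) + x(e - x) + x²(e - x) is a finite geometric series
  -- of null terms.
  let x : Hom A A := e.comp (M.proj.comp e)
  have hx k : x.app k = e.app k ≫ (M.toMul k ≫ M.ofMul k) ≫ e.app k := rfl
  have hxe k : x.app k ≫ e.app k = x.app k := by simp [hx, hee]
  have hyz k : ∃ z, M.ofMul k ≫ e.app k ≫ M.toMul k = p • z := by
    apply hp.exists_eq_smul
    have h1 : M.ofMul k ≫ e.app k ≫ M.toMul k = M.ofMul k ≫ M.toMul k -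
        (M.ofMul k ≫ M.toMul k) ≫ r ≫ u k ≫ i ≫ (M.ofMul k ≫ M.toMul k) := by
      simp [he1, M']
    rw [h1, smul_sub, smul_comp_congr (hw k) (smul_comp_congr rfl (smul_comp_congr (hu k)
      (smul_comp_congr rfl (hw k)))), hw, Category.id_comp, reassoc_of% hri, he, he, sub_self]
  have hx3 k : x.app k ≫ x.app k ≫ x.app k = 0 := by
    obtain ⟨z, hz⟩ := hyz k
    have : x.app k ≫ x.app k ≫ x.app k = e.app k ≫ M.toMul k ≫ (M.ofMul k ≫ e.app k ≫ M.toMul k) ≫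
        (M.ofMul k ≫ e.app k ≫ M.toMul k) ≫ M.ofMul k ≫ e.app k := by
      simp only [hx, Category.assoc, reassoc_of% hee]
    rw [this, hz]
    simp [hp.smul_smul_eq_zero]
  have hN := (M.null.comp_left e).comp_right e
  refine ⟨F', ⟨M', ?_⟩, hM'⟩
  convert (hN.add (hN.comp_left x)).add ((hN.comp_left x).comp_left x) using 2 with k
  have h1 : (e.app k ≫ (𝟙 (A.obj k) - M.toMul k ≫ M.ofMul k)) ≫ e.app k = e.app k - x.app k := by
    simp [hx, hee]
  rw [h1, ← he1]
  simp only [Preadditive.comp_sub, hxe, hx3]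
  abel

end Seq.MulRetract

end

/-! ### Rotation -/

section

namespace Seq

/-- A family on `Fin (N + 1)` given by its value at zero and its values at successors. -/
def rotFam {N : ℕ} {P : Fin (N + 1) → Sort*} (b : P ⟨0, Nat.succ_pos _⟩)
    (a : ∀ k (h : k + 1 < N + 1), P ⟨k + 1, h⟩) : ∀ k, P k
  | ⟨0, _⟩ => b
  | ⟨k + 1, h⟩ => a k h

variable {C : Type u} [Category.{v} C] [Preadditive C] {R : Type w} [CommRing R] [Linear R C]
  {m : ℕ}

theorem negOnePow_smul_smul (k : ℕ) {X Y : C} (f : X ⟶ Y) :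
    ((-1 : ℤ) ^ k) • ((-1 : ℤ) ^ k) • f = f := by
  rw [smul_smul, ← mul_pow]; simp

theorem zsmul_comp_eq_comp_zsmul (n : ℤ) {X Y Z : C} (f : X ⟶ Y) (g : Y ⟶ Z) :
    (n • f) ≫ g = f ≫ (n • g) := by
  rw [Preadditive.comp_zsmul, Preadditive.zsmul_comp]

theorem isCandidate_rotate_iff {A : Seq (𝟭 C) m} : A.rotate.IsCandidate ↔ A.IsCandidate := by
  constructor
  · intro h
    refine ⟨fun k hk => ?_, h.map_map 0 (by omega), ?_⟩
    · by_cases hk' : k + 3 < m + 3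
      · exact h.map_map (k + 1) hk'
      · obtain rfl : k = m := by omega
        have h1 : (((-1 : ℤ) ^ (k + 3)) • A.map (k + 1) (Nat.lt_succ_self _)) ≫
          A.map k (by omega) = 0 := h.last_map
        rw [Preadditive.zsmul_comp] at h1
        rw [← negOnePow_smul_smul (k + 3) (A.map (k + 1) _ ≫ A.map k _), h1, smul_zero]
    · have h1 : A.lst ≫ (((-1 : ℤ) ^ (m + 3)) • A.map (m + 1) (Nat.lt_succ_self _)) = 0 :=
        h.map_last
      rw [Preadditive.comp_zsmul] at h1
      change A.lst ≫ A.map (m + 1) (Nat.lt_succ_self _) = 0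
      rw [← negOnePow_smul_smul (m + 3) (A.lst ≫ _), h1, smul_zero]
  · intro h
    refine ⟨fun k hk => ?_, ?_, ?_⟩
    · cases k with
      | zero => exact h.map_last
      | succ k => exact h.map_map k (by omega)
    · change A.lst ≫ (((-1 : ℤ) ^ (m + 3)) • A.map (m + 1) (Nat.lt_succ_self _)) = 0
      rw [Preadditive.comp_zsmul, h.lst_map, smul_zero]
    · change (((-1 : ℤ) ^ (m + 3)) • A.map (m + 1) (Nat.lt_succ_self _)) ≫
          A.map m (by omega) = 0
      rw [Preadditive.zsmul_comp, h.map_map m (by omega), smul_zero]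

namespace MulRetract

variable {p : R} {A B : Seq (𝟭 C) m} {F G : C}

theorem negOnePow_smul_smul_of (hs : ((-1 : ℤ) ^ (m + 3)) • p = p) {X Y : C} (f : X ⟶ Y) :
    ((-1 : ℤ) ^ (m + 3)) • p • f = p • f := by
  rw [← smul_assoc, hs]

/-- The rotation of a homotopy retract. -/
def rotate (hs : ((-1 : ℤ) ^ (m + 3)) • p = p) (M : MulRetract p A F) :
    MulRetract p A.rotate F where
  toMul := rotFam (M.toMul ⟨m + 2, Nat.lt_succ_self _⟩) fun k h => M.toMul ⟨k, by omega⟩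
  ofMul := rotFam (M.ofMul ⟨m + 2, Nat.lt_succ_self _⟩) fun k h => M.ofMul ⟨k, by omega⟩
  map_to
    | 0, _ => M.lst_to
    | k + 1, h => M.map_to k _
  lst_to := by
    have : (((-1 : ℤ) ^ (m + 3)) • A.map (m + 1) (Nat.lt_succ_self _)) ≫ M.toMul _ =
        p • M.toMul ⟨m + 2, Nat.lt_succ_self _⟩ := by
      rw [Preadditive.zsmul_comp, M.map_to, negOnePow_smul_smul_of hs]
    exact this
  ofMul_map
    | 0, _ => M.ofMul_lst
    | k + 1, h => M.ofMul_map k _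
  ofMul_lst := by
    have : M.ofMul _ ≫ (((-1 : ℤ) ^ (m + 3)) • A.map (m + 1) (Nat.lt_succ_self _)) =
        p • M.ofMul ⟨m + 1, by omega⟩ := by
      rw [Preadditive.comp_zsmul, M.ofMul_map, negOnePow_smul_smul_of hs]
    exact this
  null := by
    obtain ⟨Θ, Λ, h⟩ := M.null
    -- The last map of the rotation carries the sign (-1)^n. Giving the diagonal opposite to it the
    -- same sign makes the signs cancel in the boundary.
    refine ⟨fun
      | 0, _ => Λ
      | k + 1, hk => Θ k (by omega), ((-1 : ℤ) ^ (m + 3)) • Θ (m + 1) (Nat.lt_succ_self _), ?_, ?_,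
          ?_⟩
    · rintro (_ | k) hk
      · exact h.zero
      · exact h.mid k (by omega)
    · refine h.last.trans ?_
      congr 1
      change _ = (((-1 : ℤ) ^ (m + 3)) • A.map (m + 1) (Nat.lt_succ_self _)) ≫
        (((-1 : ℤ) ^ (m + 3)) • Θ (m + 1) (Nat.lt_succ_self _))
      rw [Preadditive.comp_zsmul, Preadditive.zsmul_comp, negOnePow_smul_smul]
    · refine (h.mid m (by omega)).trans ?_
      congr 1
      change _ = (((-1 : ℤ) ^ (m + 3)) • Θ (m + 1) (Nat.lt_succ_self _)) ≫
        (((-1 : ℤ) ^ (m + 3)) • A.map (m + 1) (Nat.lt_succ_self _))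
      rw [Preadditive.comp_zsmul, Preadditive.zsmul_comp, negOnePow_smul_smul]

/-- Homotopy retracts can be rotated back. -/
theorem nonempty_of_rotate (hs : ((-1 : ℤ) ^ (m + 3)) • p = p) (M : MulRetract p A.rotate F) :
    Nonempty (MulRetract p A F) := by
  obtain ⟨T, hT, hT'⟩ := exists_extend_last (N := m + 2) (P := fun k h => A.obj ⟨k, h⟩ ⟶ F)
    (fun k h => M.toMul ⟨k + 1, by omega⟩) (M.toMul ⟨0, by omega⟩)
  obtain ⟨O, hO, hO'⟩ := exists_extend_last (N := m + 2) (P := fun k h => F ⟶ A.obj ⟨k, h⟩)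
    (fun k h => M.ofMul ⟨k + 1, by omega⟩) (M.ofMul ⟨0, by omega⟩)
  obtain ⟨Θ, Λ, h⟩ := M.null
  obtain ⟨H, hH, hH'⟩ := exists_extend_last (N := m + 1)
    (P := fun k h => A.obj ⟨k, by omega⟩ ⟶ A.obj ⟨k + 1, by omega⟩)
    (fun k h => Θ (k + 1) (by omega)) (((-1 : ℤ) ^ (m + 3)) • Λ)
  refine ⟨{
    toMul k := T k.1 k.2
    ofMul k := O k.1 k.2
    map_to k h := ?_
    lst_to := ?_
    ofMul_map k h := ?_
    ofMul_lst := ?_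
    null := ⟨fun k hk => H k (by omega), Θ 0 (by omega), fun k hk => ?_, ?_, ?_⟩ }⟩
  · dsimp only
    by_cases hk : k + 1 < m + 2
    · rw [hT k (by omega), hT (k + 1) hk]
      exact M.map_to (k + 1) (by omega)
    · obtain rfl : k = m + 1 := by omega
      have h1 : (((-1 : ℤ) ^ (m + 3)) • A.map (m + 1) (Nat.lt_succ_self _)) ≫
        T (m + 1) (by omega) = p • T (m + 2) (by omega) := by
        rw [hT (m + 1) (by omega), hT']
        exact M.lst_to
      rw [← negOnePow_smul_smul_of hs, ← h1, Preadditive.zsmul_comp, negOnePow_smul_smul]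
  · dsimp only
    rw [hT', hT 0 (by omega)]
    exact M.map_to 0 (by omega)
  · dsimp only
    by_cases hk : k + 1 < m + 2
    · rw [hO k (by omega), hO (k + 1) hk]
      exact M.ofMul_map (k + 1) (by omega)
    · obtain rfl : k = m + 1 := by omega
      have h1 : O (m + 2) (by omega) ≫ (((-1 : ℤ) ^ (m + 3)) • A.map (m + 1) (Nat.lt_succ_self _)) =
          p • O (m + 1) (by omega) := by
        rw [hO (m + 1) (by omega), hO']
        exact M.ofMul_lst
      rw [← negOnePow_smul_smul_of hs, ← h1, Preadditive.comp_zsmul, negOnePow_smul_smul]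
  · dsimp only
    rw [hO', hO 0 (by omega)]
    exact M.ofMul_map 0 (by omega)
  · dsimp only
    by_cases hk' : k + 1 < m + 1
    · rw [hT (k + 1) (by omega), hO (k + 1) (by omega), hH k (by omega), hH (k + 1) hk']
      exact h.mid (k + 1) (by omega)
    · obtain rfl : k = m := by omega
      rw [hT (k + 1) (by omega), hO (k + 1) (by omega), hH k (by omega), hH']
      refine h.last.trans (congrArg₂ _ rfl ?_)
      exact (zsmul_comp_eq_comp_zsmul _ Λ (A.map (k + 1) (Nat.lt_succ_self _))).symm
  · dsimp only
    rw [hT 0 (by omega), hO 0 (by omega), hH 0 (by omega)]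
    exact h.mid 0 (by omega)
  · dsimp only
    rw [hT', hO', hH']
    refine h.zero.trans (congrArg₂ _ ?_ rfl)
    exact zsmul_comp_eq_comp_zsmul _ (A.map (m + 1) (Nat.lt_succ_self _)) Λ

end MulRetract

end Seq

end

/-! ### Homotopy retracts as a class of angles, and basic first morphisms -/

section

namespace Seq

variable {C : Type u} [Category.{v} C] [Preadditive C] {R : Type w} [CommRing R] [Linear R C]
  {m : ℕ} {p : R}

variable (C m) in
/-- Candidates which are homotopy retracts of a constant sequence with maps multiplication by `p`. -/
def mulAngles (p : R) : Set (Seq (𝟭 C) m) :=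
  {A | A.IsCandidate ∧ ∃ F, Nonempty (MulRetract p A F)}

theorem mem_mulAngles_of_contractible [HasZeroObject C] {A : Seq (𝟭 C) m} (hA : A.IsCandidate)
    (hA' : A.IsContractible) : A ∈ mulAngles C m p :=
  ⟨hA, 0, ⟨.ofContractible hA' 0⟩⟩

theorem mem_mulAngles_of_isomorphic {A B : Seq (𝟭 C) m} (h : A.Isomorphic B)
    (hB : B ∈ mulAngles C m p) : A ∈ mulAngles C m p := by
  obtain ⟨hB, F, ⟨M⟩⟩ := hB
  obtain ⟨M', -⟩ := M.exists_ofIso h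
  obtain ⟨φ, hφ⟩ := h
  exact ⟨hB.of_retract φ φ.symm (by simp), F, ⟨M'⟩⟩

theorem rotate_mem_mulAngles_iff (hs : ((-1 : ℤ) ^ (m + 3)) • p = p) {A : Seq (𝟭 C) m} :
    A.rotate ∈ mulAngles C m p ↔ A ∈ mulAngles C m p := by
  refine and_congr isCandidate_rotate_iff ⟨?_, ?_⟩
  · rintro ⟨F, ⟨M⟩⟩
    exact ⟨F, M.nonempty_of_rotate hs⟩
  · rintro ⟨F, ⟨M⟩⟩
    exact ⟨F, ⟨M.rotate hs⟩⟩

theorem const_mem_mulAngles (hp : p * p = 0) (F : C) : const m p F ∈ mulAngles C m p :=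
  ⟨isCandidate_const hp F, F, ⟨.refl m p F⟩⟩

section Trivial

variable [HasZeroObject C] (X : C)

theorem isZero_trivial_obj (k : ℕ) (hk : k ≤ m) (h : k < m + 3) :
    IsZero ((Seq.trivial (𝟭 C) m X).obj ⟨k, h⟩) := by
  have : (Seq.trivial (𝟭 C) m X).obj ⟨k, h⟩ = 0 := if_pos hk
  rw [this]
  exact isZero_zero C

theorem trivial_obj (k : ℕ) (hk : ¬ k ≤ m) (h : k < m + 3) :
    (Seq.trivial (𝟭 C) m X).obj ⟨k, h⟩ = X := if_neg hk

theorem trivial_map (k : ℕ) (hk : ¬ k ≤ m) (h : k + 1 < m + 3) :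
    (Seq.trivial (𝟭 C) m X).map k h =
      eqToHom ((trivial_obj X (k + 1) (by omega) h).trans (trivial_obj X k hk (by omega)).symm) :=
  dif_neg hk

theorem trivial_mem_mulAngles : Seq.trivial (𝟭 C) m X ∈ mulAngles C m p := by
  apply mem_mulAngles_of_contractible
  · exact ⟨fun k hk => (isZero_trivial_obj X k (by omega) _).eq_of_tgt _ _, comp_zero,
      (isZero_trivial_obj X 0 (by omega) _).eq_of_src _ _⟩
  · rw [isContractible_iff]
    refine ⟨fun k hk => if h : k ≤ m then 0 else
        eqToHom ((trivial_obj X k h (by omega)).trans (trivial_obj X (k + 1) (by omega) hk).symm),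
      0, fun k hk => ?_, (isZero_trivial_obj X 0 (by omega) _).eq_of_src _ _, ?_⟩
    · by_cases hk' : k + 1 ≤ m
      · exact (isZero_trivial_obj X _ hk' _).eq_of_src _ _
      · rw [trivial_map X _ hk' hk, dif_neg hk', dif_pos (by omega), eqToHom_trans, eqToHom_refl,
          comp_zero, zero_add]
    · rw [trivial_map X _ (by omega), dif_neg (by omega), eqToHom_trans, eqToHom_refl,
        zero_comp, add_zero]

end Trivial

theorem rotate_iterate_mem (hs : ((-1 : ℤ) ^ (m + 3)) • p = p) {A : Seq (𝟭 C) m}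
    (hA : A ∈ mulAngles C m p) (j : ℕ) : rotate^[j] A ∈ mulAngles C m p := by
  induction j with
  | zero => exact hA
  | succ j ih =>
    rw [Function.iterate_succ_apply']
    exact (rotate_mem_mulAngles_iff hs).2 ih

theorem rotate_iterate_obj (A : Seq (𝟭 C) m) (i j k : ℕ) (hk : k < m + 3) (h : i + j = k) :
    (rotate^[j] A).obj ⟨k, hk⟩ = A.obj ⟨i, by omega⟩ := by
  subst h
  induction j with
  | zero => rfl
  | succ j ih =>
    rw [Function.iterate_succ_apply', ← ih (by omega)]
    rfl

/-- The morphism is isomorphic to the first morphism of a sequence in `mulAngles`. -/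
def IsFirst (m : ℕ) (p : R) {X Y : C} (f : X ⟶ Y) : Prop :=
  ∃ A ∈ mulAngles C m p, ∃ (e : X ≅ A.X₁) (e' : Y ≅ A.X₂), f ≫ e'.hom = e.hom ≫ A.α₁

theorem IsFirst.of_iso {X Y X' Y' : C} {f : X ⟶ Y} {g : X' ⟶ Y'} (hg : IsFirst m p g)
    (e : X ≅ X') (e' : Y ≅ Y') (h : f ≫ e'.hom = e.hom ≫ g) : IsFirst m p f := by
  obtain ⟨A, hA, i, i', hi⟩ := hg
  exact ⟨A, hA, e ≪≫ i, e' ≪≫ i', by simp [reassoc_of% h, hi]⟩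

theorem isFirst_smul_id (hp : p * p = 0) (F : C) : IsFirst m p (p • 𝟙 F) :=
  ⟨const m p F, const_mem_mulAngles hp F, Iso.refl F, Iso.refl F,
    (Category.comp_id (p • 𝟙 F)).trans (Category.id_comp (p • 𝟙 F)).symm⟩

theorem isFirst_id [HasZeroObject C] (X : C) : IsFirst m p (𝟙 X) := by
  refine ⟨_, trivial_mem_mulAngles X, eqToIso (trivial_obj X _ (by omega) _).symm,
    eqToIso (trivial_obj X _ (by omega) _).symm, ?_⟩
  rw [α₁, trivial_map X _ (by omega)]
  simp

/-- One rotation of the trivial sequence on X starts with X ⟶ A₃, and A₃ = 0 because n ≥ 3. -/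
theorem isFirst_zero_right [HasZeroObject C] (hs : ((-1 : ℤ) ^ (m + 3)) • p = p) (X : C) {Z : C}
    (hZ : IsZero Z) : IsFirst m p (0 : X ⟶ Z) :=
  have h : IsZero (Seq.trivial (𝟭 C) m X).rotate.X₂ := isZero_trivial_obj X m le_rfl (by omega)
  ⟨_, (rotate_mem_mulAngles_iff hs).2 (trivial_mem_mulAngles X),
    eqToIso (trivial_obj X (m + 1) (by omega) (by omega)).symm, hZ.iso h, h.eq_of_tgt _ _⟩

/-- After n - 1 = m + 2 rotations the trivial sequence on Y starts with Aₙ ⟶ Σ A₁, that is, with 0 ⟶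
Y. -/
theorem isFirst_zero_left [HasZeroObject C] (hs : ((-1 : ℤ) ^ (m + 3)) • p = p) (Y : C) {Z : C}
    (hZ : IsZero Z) : IsFirst m p (0 : Z ⟶ Y) := by
  have h₁ : IsZero (rotate^[m + 2] (Seq.trivial (𝟭 C) m Y)).X₁ := by
    rw [X₁, rotate_iterate_obj _ 0 (m + 2) (m + 2) _ (by omega)]
    exact isZero_trivial_obj Y 0 (by omega) _
  have h₂ : (rotate^[m + 2] (Seq.trivial (𝟭 C) m Y)).X₂ = Y := by
    rw [X₂, Function.iterate_succ_apply, rotate_iterate_obj _ 0 (m + 1) (m + 1) _ (by omega)]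
    exact trivial_obj Y (m + 2) (by omega) (by omega)
  exact ⟨_, rotate_iterate_mem hs (trivial_mem_mulAngles Y) (m + 2), hZ.iso h₁, eqToIso h₂.symm,
    hZ.eq_of_src _ _⟩

variable [HasBinaryBiproducts C]

theorem sum_mem_mulAngles {A B : Seq (𝟭 C) m} (hA : A ∈ mulAngles C m p)
    (hB : B ∈ mulAngles C m p) : A.sum B ∈ mulAngles C m p := by
  obtain ⟨hA, F, ⟨M⟩⟩ := hA
  obtain ⟨hB, G, ⟨N⟩⟩ := hB
  exact ⟨hA.sum hB, _, ⟨M.sum N⟩⟩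

/-- A retract of a homotopy retract is a homotopy retract of the same constant sequence. This is the
gain from describing angles by retracts rather than by decompositions. -/
theorem mem_mulAngles_of_sum_mem {A B : Seq (𝟭 C) m} (h : A.sum B ∈ mulAngles C m p) :
    A ∈ mulAngles C m p := by
  obtain ⟨h, F, ⟨M⟩⟩ := h
  exact ⟨h.of_retract (sumInl A B) (sumFst A B) (by simp), F,
    ⟨M.ofRetract (sumInl A B) (sumFst A B) (by simp)⟩⟩

theorem mem_mulAngles_iff_exists_isomorphic [IsIdempotentComplete C] (hp : IsUniformScalar C p)
    {A : Seq (𝟭 C) m} : A ∈ mulAngles C m p ↔ ∃ (K : Seq (𝟭 C) m) (F : C),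
      K.IsCandidate ∧ K.IsContractible ∧ A.Isomorphic (K.sum (const m p F)) := by
  constructor
  · rintro ⟨hA, F, ⟨M⟩⟩
    obtain ⟨F', M', hM'⟩ := M.exists_strict hp
    obtain ⟨K, h⟩ := M'.exists_isomorphic_sum hA hM'
    exact ⟨K, F', h⟩
  · rintro ⟨K, F, hK, hK', h⟩
    exact mem_mulAngles_of_isomorphic h
      ⟨hK.sum (isCandidate_const hp.mul_self F), F, ⟨(MulRetract.refl m p F).contractibleSum hK'⟩⟩

theorem IsFirst.map {X Y X' Y' : C} {f : X ⟶ Y} {g : X' ⟶ Y'} (hf : IsFirst m p f)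
    (hg : IsFirst m p g) : IsFirst m p (biprod.map f g) := by
  obtain ⟨A, hA, i, i', hi⟩ := hf
  obtain ⟨B, hB, j, j', hj⟩ := hg
  refine ⟨A.sum B, sum_mem_mulAngles hA hB, biprod.mapIso i j, biprod.mapIso i' j', ?_⟩
  change biprod.map f g ≫ biprod.map _ _ = biprod.map _ _ ≫ biprod.map A.α₁ B.α₁
  apply biprod.hom_ext' <;> simp [reassoc_of% hi, reassoc_of% hj]

theorem isFirst_zero [HasZeroObject C] (hs : ((-1 : ℤ) ^ (m + 3)) • p = p) (X Y : C) :
    IsFirst m p (0 : X ⟶ Y) := by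
  refine ((isFirst_zero_right hs X (isZero_zero C)).map
    (isFirst_zero_left hs Y (isZero_zero C))).of_iso (isoBiprodZero (isZero_zero C))
      (isoZeroBiprod (isZero_zero C)) ?_
  apply biprod.hom_ext <;> simp

end Seq

end

/-! ### Normal form of a morphism and axiom (N1)(c) -/

section

/-- The polynomial q = 4a² - 3a³ comes from the Chinese remainder theorem: it is 0 modulo a², and
modulo (a - 1)² it is 2 - a, the inverse of a. So q a q - q is divisible by a²(a - 1)². -/
theorem quasi_inverse_of_sq {E : Type*} [Ring E] (a : E) (h : (a * a - a) * (a * a - a) = 0) :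
    (4 • (a * a) - 3 • (a * (a * a))) * (a * (4 • (a * a) - 3 • (a * (a * a)))) =
      4 • (a * a) - 3 • (a * (a * a)) := by
  rw [← sub_eq_zero]
  have : (4 • (a * a) - 3 • (a * (a * a))) * (a * (4 • (a * a) - 3 • (a * (a * a)))) -
      (4 • (a * a) - 3 • (a * (a * a))) =
        ((a * a - a) * (a * a - a)) * ((3 * a - 4) * (3 * (a * a) + 2 * a + 1)) := by
    noncomm_ring
  rw [this, h, zero_mul]

variable {C : Type u} [Category.{v} C] [Preadditive C] {R : Type w} [CommRing R] [Linear R C]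
  {m : ℕ} {p : R}

namespace IsUniformScalar

/-- A weak inverse modulo p is corrected by a polynomial in f ≫ s. Modulo p the powers of f ≫ s fix
f, so the correction acts there as 4 - 3 = 1. Only one of the two identities can be exact: for a
nonzero f = pθ, f ≫ s ≫ f vanishes for every s. -/
theorem exists_quasi_inverse (hp : IsUniformScalar C p) {X Y : C} (f : X ⟶ Y) :
    ∃ s : Y ⟶ X, s ≫ f ≫ s = s ∧ p • (f ≫ s ≫ f) = p • f := by
  obtain ⟨s, t, h⟩ := hp.exists_regular f
  have h1 : p • ((f ≫ s) ≫ f) = p • f := by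
    rw [Category.assoc, h, smul_add, hp.smul_smul_eq_zero, add_zero]
  have h2 : p • ((f ≫ s) ≫ (f ≫ s) ≫ f) = p • f := by
    rw [smul_comp_congr rfl h1, h1]
  have h3 : p • ((f ≫ s) ≫ (f ≫ s) ≫ (f ≫ s) ≫ f) = p • f := by
    rw [smul_comp_congr rfl h2, h1]
  have h4 : p • ((f ≫ s) ≫ (f ≫ s) ≫ (f ≫ s) ≫ (f ≫ s) ≫ f) = p • f := by
    rw [smul_comp_congr rfl h3, h1]
  have ha : (f ≫ s) ≫ (f ≫ s) - (f ≫ s) = p • (t ≫ s) := by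
    simp only [Category.assoc]
    rw [← Category.assoc f s (f ≫ s), ← Category.assoc (f ≫ s) f s, Category.assoc f s f, h,
      Preadditive.add_comp, Linear.smul_comp]
    abel
  have hq := quasi_inverse_of_sq (show End X from f ≫ s) (by
    change ((f ≫ s) ≫ (f ≫ s) - (f ≫ s)) ≫ ((f ≫ s) ≫ (f ≫ s) - (f ≫ s)) = 0
    rw [ha, Linear.smul_comp, Linear.comp_smul, hp.smul_smul_eq_zero])
  let q : X ⟶ X := 4 • ((f ≫ s) ≫ (f ≫ s)) - 3 • (((f ≫ s) ≫ (f ≫ s)) ≫ (f ≫ s))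
  replace hq : (q ≫ (f ≫ s)) ≫ q = q := hq
  refine ⟨s ≫ q, ?_, ?_⟩
  · simp only [Category.assoc] at hq
    simp only [Category.assoc, hq]
  · have : f ≫ (s ≫ q) ≫ f = 4 • ((f ≫ s) ≫ (f ≫ s) ≫ (f ≫ s) ≫ f) -
        3 • ((f ≫ s) ≫ (f ≫ s) ≫ (f ≫ s) ≫ (f ≫ s) ≫ f) := by
      simp only [q, Preadditive.comp_sub, Preadditive.sub_comp, Preadditive.comp_nsmul,
        Preadditive.nsmul_comp, Category.assoc]
    rw [this, smul_sub, smul_comm p, smul_comm p, h3, h4]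
    abel

variable [HasBinaryBiproducts C] [IsIdempotentComplete C]

/-- The idempotents f ≫ s on X and s ≫ f on Y have images identified by f; their common image is U.
On the complements f acts as f - f ≫ s ≫ f, which is divisible by p. -/
theorem exists_iso_map (hp : IsUniformScalar C p) {X Y : C} (f : X ⟶ Y) :
    ∃ (U X' Y' : C) (e : X ≅ U ⊞ X') (e' : Y ≅ U ⊞ Y') (θ : X' ⟶ Y'),
      f ≫ e'.hom = e.hom ≫ biprod.map (𝟙 U) (p • θ) := by
  obtain ⟨s, hs, hf⟩ := hp.exists_quasi_inverse f
  obtain ⟨t, ht⟩ := hp.exists_eq_add_smul hf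
  obtain ⟨U, i, r, hir, hri⟩ := IsIdempotentComplete.idempotents_split X (f ≫ s) (by
    rw [Category.assoc, hs])
  obtain ⟨X', j, q, hjq, hqj⟩ := IsIdempotentComplete.idempotents_split X (𝟙 X - f ≫ s) (by
    simp [hs])
  obtain ⟨Y', j', q', hjq', hqj'⟩ := IsIdempotentComplete.idempotents_split Y (𝟙 Y - s ≫ f) (by
    simp [reassoc_of% hs])
  have hj : j ≫ (𝟙 X - f ≫ s) = j := by rw [← hqj, reassoc_of% hjq]
  have hq : (𝟙 X - f ≫ s) ≫ q = q := by rw [← hqj, Category.assoc, hjq, Category.comp_id]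
  have hj' : j' ≫ (𝟙 Y - s ≫ f) = j' := by rw [← hqj', reassoc_of% hjq']
  have hq' : (𝟙 Y - s ≫ f) ≫ q' = q' := by rw [← hqj', Category.assoc, hjq', Category.comp_id]
  have hi : i ≫ f ≫ s = i := by rw [← hri, reassoc_of% hir]
  have hr : f ≫ s ≫ r = r := by rw [← Category.assoc, ← hri, Category.assoc, hir, Category.comp_id]
  have hjf : j ≫ f ≫ s = 0 := by simpa using hj
  have hfq : f ≫ s ≫ q = 0 := by simpa using hq
  have hjf' : j' ≫ s ≫ f = 0 := by simpa using hj'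
  have hfq' : s ≫ f ≫ q' = 0 := by simpa using hq'
  have hjr : j ≫ r = 0 := by rw [← hr, reassoc_of% hjf, zero_comp]
  have hiq : i ≫ q = 0 := by rw [← hi, Category.assoc, Category.assoc, hfq, comp_zero]
  refine ⟨U, X', Y', ⟨biprod.lift r q, biprod.desc i j, ?_, ?_⟩,
    ⟨biprod.lift (s ≫ r) q', biprod.desc (i ≫ f) j', ?_, ?_⟩, -(j ≫ t ≫ q'), ?_⟩
  · rw [biprod.lift_desc, hri, hqj]; abel
  · apply biprod.hom_ext' <;> apply biprod.hom_ext <;> simp [hir, hjr, hiq, hjq]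
  · rw [biprod.lift_desc, hqj', Category.assoc, reassoc_of% hri, reassoc_of% hs]; abel
  · have h1 : j' ≫ s ≫ r = 0 := by rw [← hr, ← Category.assoc s, ← Category.assoc j', hjf',
      zero_comp]
    have h2 : i ≫ f ≫ q' = 0 := by rw [← hi, Category.assoc, Category.assoc, hfq', comp_zero,
        comp_zero]
    apply biprod.hom_ext' <;> apply biprod.hom_ext <;> simp [hr, hir, h1, h2, hjq']
  · apply biprod.hom_ext
    · simp [hr]
    · have h1 : j ≫ f + p • (j ≫ t) = 0 := by
        rw [← Linear.comp_smul, ← Preadditive.comp_add, ← ht, reassoc_of% hjf, zero_comp]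
      have h2 : f ≫ q' = q ≫ j ≫ f ≫ q' := by
        rw [reassoc_of% hqj, Preadditive.sub_comp, Category.assoc, hfq', comp_zero, sub_zero,
          Category.id_comp]
      have h3 : f ≫ q' = q ≫ (p • -(j ≫ t ≫ q')) := by
        rw [h2, reassoc_of% eq_neg_of_add_eq_zero_left h1]
        simp
      simpa using h3

end IsUniformScalar

namespace Seq

/-- The normal form is used twice. It leaves pθ as remainder for f, and applied to θ it shows that
pθ is p1 ⊕ 0, as p² = 0. -/
theorem isFirst_of_isUniformScalar [HasBinaryBiproducts C] [IsIdempotentComplete C]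
    [HasZeroObject C] (hp : IsUniformScalar C p)
    (hs : ((-1 : ℤ) ^ (m + 3)) • p = p) {X Y : C} (f : X ⟶ Y) : IsFirst m p f := by
  have key {X Y : C} (f : X ⟶ Y) : IsFirst m p (p • f) := by
    obtain ⟨U, X', Y', e, e', θ, h⟩ := hp.exists_iso_map f
    refine ((isFirst_smul_id hp.mul_self U).map (isFirst_zero hs X' Y')).of_iso e e' ?_
    rw [Linear.smul_comp, h, ← Linear.comp_smul]
    congr 1
    apply biprod.hom_ext' <;> apply biprod.hom_ext <;> simp [hp.smul_smul_eq_zero]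
  obtain ⟨U, X', Y', e, e', θ, h⟩ := hp.exists_iso_map f
  exact ((isFirst_id U).map (key θ)).of_iso e e' h

/-- The axiom asks for an equality of arrows, so the first two objects of the sequence are replaced
by the given X and Y and its maps are conjugated accordingly. -/
theorem IsFirst.exists_arrow_eq {X Y : C} {f : X ⟶ Y} (hf : IsFirst m p f) :
    ∃ A ∈ mulAngles C m p, Arrow.mk A.α₁ = Arrow.mk f := by
  obtain ⟨A, hA, e, e', h⟩ := hf
  obtain ⟨g, -, hg'⟩ := exists_extend_last (N := m + 1)
    (P := fun k h => Σ Z : C, (Z ≅ A.obj ⟨k, by omega⟩)) (fun k h => ⟨_, Iso.refl _⟩) ⟨Y, e'⟩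
  obtain ⟨z, hz, hz'⟩ := exists_extend_last (N := m + 2)
    (P := fun k h => Σ Z : C, (Z ≅ A.obj ⟨k, by omega⟩)) g ⟨X, e⟩
  let B : Seq (𝟭 C) m :=
    { obj k := (z k.1 k.2).1
      map k h := (z (k + 1) h).2.hom ≫ A.map k h ≫ (z k _).2.inv
      last := (z 0 _).2.hom ≫ A.lst ≫ (z (m + 2) _).2.inv }
  refine ⟨B, mem_mulAngles_of_isomorphic ⟨Hom.mk' (fun k => (z k.1 k.2).2.hom) (fun k h => ?_) ?_,
    fun k => ?_⟩ hA, ?_⟩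
  · simp [B]
  · have key {X Y Z W : C} (a : X ⟶ Y) (b : Y ⟶ Z) (i : W ≅ Z) :
        (a ≫ b ≫ i.inv) ≫ i.hom = a ≫ b := by simp
    exact key _ _ _
  · exact inferInstanceAs (IsIso (z k.1 k.2).2.hom)
  · have h1 : z (m + 1) (by omega) = ⟨Y, e'⟩ := by rw [hz (m + 1) (by omega), hg']
    change Arrow.mk ((z (m + 2) (by omega)).2.hom ≫ A.α₁ ≫ (z (m + 1) (by omega)).2.inv) = _
    rw [h1, hz', ← reassoc_of% h, e'.hom_inv_id, Category.comp_id]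

end Seq

end

/-! ### Degreewise split extensions of homotopy retracts -/

section

namespace Seq

variable {C : Type u} [Category.{v} C] [Preadditive C] {R : Type w} [CommRing R] [Linear R C]
  {m : ℕ} {p : R}

/-- `D` is a degreewise split extension of `P` by `Q` with connecting family `(t, tl)`. -/
structure Extension (P Q D : Seq (𝟭 C) m)
    (t : ∀ k (h : k + 1 < m + 3), P.obj ⟨k + 1, h⟩ ⟶ Q.obj ⟨k, Nat.lt_of_succ_lt h⟩)
    (tl : P.obj ⟨0, Nat.succ_pos _⟩ ⟶ Q.obj ⟨m + 2, Nat.lt_succ_self _⟩) where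
  inl k : P.obj k ⟶ D.obj k
  inr k : Q.obj k ⟶ D.obj k
  fst k : D.obj k ⟶ P.obj k
  snd k : D.obj k ⟶ Q.obj k
  inl_fst k : inl k ≫ fst k = 𝟙 _
  inl_snd k : inl k ≫ snd k = 0
  inr_fst k : inr k ≫ fst k = 0
  inr_snd k : inr k ≫ snd k = 𝟙 _
  total k : fst k ≫ inl k + snd k ≫ inr k = 𝟙 _
  map_fst k h : D.map k h ≫ fst ⟨k, Nat.lt_of_succ_lt h⟩ = fst ⟨k + 1, h⟩ ≫ P.map k h
  map_snd k h : D.map k h ≫ snd ⟨k, Nat.lt_of_succ_lt h⟩ =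
    fst ⟨k + 1, h⟩ ≫ t k h + snd ⟨k + 1, h⟩ ≫ Q.map k h
  lst_fst : D.lst ≫ fst ⟨m + 2, Nat.lt_succ_self _⟩ = fst ⟨0, Nat.succ_pos _⟩ ≫ P.lst
  lst_snd : D.lst ≫ snd ⟨m + 2, Nat.lt_succ_self _⟩ =
    fst ⟨0, Nat.succ_pos _⟩ ≫ tl + snd ⟨0, Nat.succ_pos _⟩ ≫ Q.lst

namespace Extension

variable {P Q D D' : Seq (𝟭 C) m}
  {t t' : ∀ k (h : k + 1 < m + 3), P.obj ⟨k + 1, h⟩ ⟶ Q.obj ⟨k, Nat.lt_of_succ_lt h⟩}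
  {tl tl' : P.obj ⟨0, Nat.succ_pos _⟩ ⟶ Q.obj ⟨m + 2, Nat.lt_succ_self _⟩}

theorem hom_ext (E : Extension P Q D t tl) {k} {X : C} {f g : X ⟶ D.obj k}
    (h : f ≫ E.fst k = g ≫ E.fst k) (h' : f ≫ E.snd k = g ≫ E.snd k) : f = g := by
  rw [← Category.comp_id f, ← E.total, Preadditive.comp_add, reassoc_of% h, reassoc_of% h',
    ← Preadditive.comp_add, E.total, Category.comp_id]

theorem hom_ext' (E : Extension P Q D t tl) {k} {X : C} {f g : D.obj k ⟶ X}
    (h : E.inl k ≫ f = E.inl k ≫ g) (h' : E.inr k ≫ f = E.inr k ≫ g) : f = g := by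
  rw [← Category.id_comp f, ← E.total, Preadditive.add_comp, Category.assoc, Category.assoc, h, h',
    ← Category.assoc, ← Category.assoc, ← Preadditive.add_comp, E.total, Category.id_comp]

theorem inl_map (E : Extension P Q D t tl) (k h) : E.inl ⟨k + 1, h⟩ ≫ D.map k h =
    P.map k h ≫ E.inl _ + t k h ≫ E.inr _ := by
  apply E.hom_ext <;>
  simp [E.map_fst, E.map_snd, reassoc_of% E.inl_fst, reassoc_of% E.inl_snd, E.inl_fst, E.inl_snd,
    E.inr_fst, E.inr_snd]

theorem inr_map (E : Extension P Q D t tl) (k h) : E.inr ⟨k + 1, h⟩ ≫ D.map k h =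
    Q.map k h ≫ E.inr _ := by
  apply E.hom_ext <;>
  simp [E.map_fst, E.map_snd, reassoc_of% E.inr_fst, reassoc_of% E.inr_snd,
    E.inr_fst, E.inr_snd]

theorem inl_lst (E : Extension P Q D t tl) : E.inl ⟨0, Nat.succ_pos _⟩ ≫ D.lst =
    P.lst ≫ E.inl _ + tl ≫ E.inr _ := by
  apply E.hom_ext <;>
  simp only [Category.assoc, Preadditive.add_comp, Preadditive.comp_add, E.lst_fst, E.lst_snd,
    reassoc_of% E.inl_fst, reassoc_of% E.inl_snd, E.inl_fst, E.inl_snd,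
    E.inr_fst, E.inr_snd, comp_zero, zero_comp, add_zero, zero_add, Category.comp_id]

theorem inr_lst (E : Extension P Q D t tl) : E.inr ⟨0, Nat.succ_pos _⟩ ≫ D.lst =
    Q.lst ≫ E.inr _ := by
  apply E.hom_ext <;>
  simp only [Category.assoc, Preadditive.comp_add, E.lst_fst, E.lst_snd,
    reassoc_of% E.inr_fst, reassoc_of% E.inr_snd,
    E.inr_fst, E.inr_snd, comp_zero, zero_comp, zero_add, Category.comp_id]

/-- An extension of candidates is a candidate if the connecting family anticommutes with the
differentials. -/
theorem isCandidate (E : Extension P Q D t tl) (hP : P.IsCandidate) (hQ : Q.IsCandidate)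
    (h : ∀ k (hk : k + 2 < m + 3), P.map (k + 1) hk ≫ t k (by omega) +
      t (k + 1) hk ≫ Q.map k (by omega) = 0)
    (h' : P.map 0 (by omega) ≫ tl + t 0 _ ≫ Q.lst = 0)
    (h'' : P.lst ≫ t (m + 1) (by omega) + tl ≫ Q.map (m + 1) (by omega) = 0) : D.IsCandidate where
  map_map k hk := by
    apply E.hom_ext
    · rw [Category.assoc, E.map_fst, reassoc_of% E.map_fst, hP.map_map, comp_zero, zero_comp]
    · rw [Category.assoc, E.map_snd, Preadditive.comp_add, reassoc_of% E.map_fst,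
        reassoc_of% E.map_snd, Preadditive.add_comp, Category.assoc, Category.assoc, hQ.map_map,
        comp_zero, add_zero, ← Preadditive.comp_add, h, comp_zero, zero_comp]
  map_last := by
    change D.map 0 (by omega) ≫ D.lst = 0
    apply E.hom_ext
    · rw [Category.assoc, E.lst_fst, reassoc_of% E.map_fst, hP.map_lst, comp_zero, zero_comp]
    · rw [Category.assoc, E.lst_snd, Preadditive.comp_add, reassoc_of% E.map_fst,
        reassoc_of% E.map_snd, Preadditive.add_comp, Category.assoc, Category.assoc, hQ.map_lst,
        comp_zero, add_zero, ← Preadditive.comp_add, h', comp_zero, zero_comp]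
  last_map := by
    change D.lst ≫ D.map (m + 1) (by omega) = 0
    apply E.hom_ext
    · rw [Category.assoc, E.map_fst, reassoc_of% E.lst_fst, hP.lst_map, comp_zero, zero_comp]
    · rw [Category.assoc, E.map_snd, Preadditive.comp_add, reassoc_of% E.lst_fst,
        reassoc_of% E.lst_snd, Preadditive.add_comp, Category.assoc, Category.assoc, hQ.lst_map,
        comp_zero, add_zero, ← Preadditive.comp_add, h'', comp_zero, zero_comp]

/-- Extensions with homotopic connecting families are isomorphic. -/
theorem isomorphic (E : Extension P Q D t tl) (E' : Extension P Q D' t' tl')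
    (x : ∀ k, P.obj k ⟶ Q.obj k)
    (h : ∀ k (hk : k + 1 < m + 3), P.map k hk ≫ x _ + t k hk = t' k hk + x _ ≫ Q.map k hk)
    (hl : P.lst ≫ x _ + tl = tl' + x _ ≫ Q.lst) : D.Isomorphic D' := by
  refine ⟨Hom.mk' (fun k => E.fst k ≫ E'.inl k + E.fst k ≫ x k ≫ E'.inr k + E.snd k ≫ E'.inr k)
    (fun k hk => ?_) ?_, fun k =>
      ⟨E'.fst k ≫ E.inl k - E'.fst k ≫ x k ≫ E.inr k + E'.snd k ≫ E.inr k, ?_, ?_⟩⟩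
  · have := congrArg (fun z => E.fst _ ≫ z ≫ E'.inr _) (h k hk)
    simp only [Preadditive.comp_add, Preadditive.add_comp, Category.assoc] at this
    simp only [Preadditive.comp_add, Preadditive.add_comp, Category.assoc, E'.inl_map, E'.inr_map,
      reassoc_of% E.map_fst, reassoc_of% E.map_snd]
    rw [add_assoc, ← add_assoc (_ ≫ _ ≫ _ ≫ _), this]
    abel
  · have := congrArg (fun z => E.fst _ ≫ z ≫ E'.inr _) hl
    simp only [Preadditive.comp_add, Preadditive.add_comp, Category.assoc] at this
    simp only [Preadditive.comp_add, Preadditive.add_comp, Category.assoc, E'.inl_lst, E'.inr_lst,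
      reassoc_of% E.lst_fst, reassoc_of% E.lst_snd]
    rw [add_assoc, ← add_assoc (_ ≫ _ ≫ _ ≫ _), this]
    abel
  · rw [← E.total]
    simp [reassoc_of% E'.inl_fst, reassoc_of% E'.inl_snd, reassoc_of% E'.inr_fst,
      reassoc_of% E'.inr_snd]
    abel
  · rw [← E'.total]
    simp [reassoc_of% E.inl_fst, reassoc_of% E.inl_snd, reassoc_of% E.inr_fst,
      reassoc_of% E.inr_snd]

end Extension

/-- The contraction of the complement of a strict retract can be chosen to vanish on the retract. -/
theorem MulRetract.exists_nullBy {A : Seq (𝟭 C) m} {F : C} (M : MulRetract p A F)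
    (hM : ∀ k, M.ofMul k ≫ M.toMul k = 𝟙 _) :
    ∃ Θ Λ, NullBy (fun k => 𝟙 (A.obj k) - M.toMul k ≫ M.ofMul k) Θ Λ ∧
      (∀ k h, M.ofMul _ ≫ Θ k h = 0) ∧ (∀ k h, Θ k h ≫ M.toMul _ = 0) ∧
      M.ofMul _ ≫ Λ = 0 ∧ Λ ≫ M.toMul _ = 0 := by
  obtain ⟨Θ, Λ, h⟩ := M.null
  let e : Hom A A := (Hom.id A).sub M.proj
  have he k : e.app k = 𝟙 _ - M.toMul k ≫ M.ofMul k := rfl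
  have h1 k : e.app k ≫ M.toMul k = 0 := by simp [he, hM]
  have h2 k : M.ofMul k ≫ e.app k = 0 := by simp [he, reassoc_of% hM]
  have hee k : e.app k ≫ e.app k = e.app k := by
    calc
      _ = e.app k ≫ (𝟙 _ - M.toMul k ≫ M.ofMul k) := by rw [← he]
      _ = _ := by rw [Preadditive.comp_sub, reassoc_of% h1, zero_comp, sub_zero, Category.comp_id]
  refine ⟨fun k _ => e.app _ ≫ Θ k _ ≫ e.app _, e.app _ ≫ Λ ≫ e.app _, ?_, fun k h => ?_,
    fun k h => ?_, ?_, ?_⟩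
  · convert (h.comp_left e).comp_right e using 1
    · ext k
      change e.app k = (e.app k ≫ e.app k) ≫ e.app k
      rw [hee, hee]
    · simp
    · exact (Category.assoc _ _ _).symm
  · rw [reassoc_of% h2, zero_comp]
  · simp [h1]
  · rw [reassoc_of% h2, zero_comp]
  · simp only [Category.assoc, h1, comp_zero]

theorem negOnePow_add_succ_smul (k : ℕ) {X Y : C} (f : X ⟶ Y) :
    ((-1 : ℤ) ^ (k + 1)) • f + ((-1 : ℤ) ^ (k + 2)) • f = 0 := by
  rw [← add_smul, pow_succ _ (k + 1)]
  simp

theorem add_negOnePow_one_smul {X Y : C} (f : X ⟶ Y) : f + ((-1 : ℤ) ^ (0 + 1)) • f = 0 := by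
  simp

theorem negOnePow_smul_add_eq_zero (hs : ((-1 : ℤ) ^ (m + 3)) • p = p) {X Y : C} (f : X ⟶ Y) :
    ((-1 : ℤ) ^ (m + 2)) • p • f + p • f = 0 := by
  have := negOnePow_add_succ_smul (m + 1) (p • f)
  rwa [MulRetract.negOnePow_smul_smul_of hs] at this

theorem eq_add_of_add_eq_zero {X : Type*} [AddCommGroup X] {x y a b c d z : X} (h : c + d = 0)
    (h' : y = a + b) (hx : x = y + z) : x = c + a + (d + z + b) := by
  rw [hx, h', eq_neg_of_add_eq_zero_left h]
  abel

variable [HasBinaryBiproducts C]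

/-- The extension of two strict retracts along a von Neumann regular morphism of the underlying
objects is a homotopy retract. -/
theorem Extension.nonempty_mulRetract {P Q D : Seq (𝟭 C) m} {F G : C}
    (hs : ((-1 : ℤ) ^ (m + 3)) • p = p) (M : MulRetract p P F)
    (hM : ∀ k, M.ofMul k ≫ M.toMul k = 𝟙 _) (N : MulRetract p Q G)
    (hN : ∀ k, N.ofMul k ≫ N.toMul k = 𝟙 _) (c : F ⟶ G) (s : G ⟶ F) (hc : c ≫ s ≫ c = c)
    (E : Extension P Q D (fun k _ => ((-1 : ℤ) ^ (k + 1)) • (M.toMul _ ≫ c ≫ N.ofMul _))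
      (M.toMul _ ≫ c ≫ N.ofMul _)) : Nonempty (MulRetract p D (F ⊞ G)) := by
  obtain ⟨Θ, Λ, h, h1, h2, h3, h4⟩ := M.exists_nullBy hM
  obtain ⟨Θ', Λ', h', h1', h2', h3', h4'⟩ := N.exists_nullBy hN
  -- u projects F onto the kernel of c, and w projects G onto a complement of its image. After these
  -- projections the connecting family vanishes, so the maps to and from the constant sequence
  -- become morphisms.
  obtain ⟨u, hu⟩ : ∃ u, u = 𝟙 F - c ≫ s := ⟨_, rfl⟩
  obtain ⟨w, hw⟩ : ∃ w, w = 𝟙 G - s ≫ c := ⟨_, rfl⟩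
  have huc : u ≫ c = 0 := by simp [hu, hc]
  have hcw : c ≫ w = 0 := by simp [hw, hc]
  have huu : u ≫ u = u := by
    nth_rw 2 [hu]
    rw [Preadditive.comp_sub, reassoc_of% huc, zero_comp, sub_zero, Category.comp_id]
  have hww : w ≫ w = w := by
    nth_rw 1 [hw]
    rw [Preadditive.sub_comp, Category.assoc, hcw, comp_zero, sub_zero, Category.id_comp]
  have hu' {X Y : C} (x : X ⟶ F) (y : F ⟶ Y) : x ≫ u ≫ y = x ≫ y - x ≫ c ≫ s ≫ y := by simp [hu]
  have hw' {X Y : C} (x : X ⟶ G) (y : G ⟶ Y) : x ≫ w ≫ y = x ≫ y - x ≫ s ≫ c ≫ y := by simp [hw]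
  refine ⟨{
    toMul k := E.fst k ≫ M.toMul k ≫ u ≫ biprod.inl + E.snd k ≫ N.toMul k ≫ w ≫ biprod.inr
    ofMul k := biprod.fst ≫ u ≫ M.ofMul k ≫ E.inl k + biprod.snd ≫ w ≫ N.ofMul k ≫ E.inr k
    map_to k h := ?_
    lst_to := ?_
    ofMul_map k h := ?_
    ofMul_lst := ?_
    -- The contractions of the complements in P and Q are joined by s, running from Q back to P
    -- against the connecting family, which contracts the part where c is invertible. The
    -- alternating signs make its unwanted terms cancel between neighbouring degrees; where the
    -- sequence closes up, this uses (-1)^n p = p.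
    null := ⟨fun k hk => E.fst _ ≫ Θ k hk ≫ E.inl _ +
        ((-1 : ℤ) ^ (k + 1)) • (E.snd _ ≫ N.toMul _ ≫ s ≫ M.ofMul _ ≫ E.inl _) +
        E.snd _ ≫ Θ' k hk ≫ E.inr _,
      E.fst _ ≫ Λ ≫ E.inl _ + E.snd _ ≫ N.toMul _ ≫ s ≫ M.ofMul _ ≫ E.inl _ +
        E.snd _ ≫ Λ' ≫ E.inr _, fun k hk => ?_, ?_, ?_⟩ }⟩
  · simp only [Preadditive.comp_add, Preadditive.add_comp, reassoc_of% E.map_fst,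
      reassoc_of% E.map_snd, Category.assoc,
      reassoc_of% hN, reassoc_of% hcw, M.map_to_assoc, N.map_to_assoc, Linear.smul_comp,
      Linear.comp_smul, zero_comp, comp_zero, smul_zero, zero_add, smul_add]
  · simp only [Preadditive.comp_add, Preadditive.add_comp, reassoc_of% E.lst_fst,
      reassoc_of% E.lst_snd, Category.assoc,
      reassoc_of% hN, reassoc_of% hcw, M.lst_to_assoc, N.lst_to_assoc, Linear.smul_comp,
      Linear.comp_smul, zero_comp, comp_zero, zero_add, smul_add]
  · simp only [Preadditive.comp_add, Preadditive.add_comp, E.inl_map, E.inr_map,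
      Category.assoc,
      reassoc_of% hM, reassoc_of% huc, M.ofMul_map_assoc, N.ofMul_map_assoc, Linear.smul_comp,
      Linear.comp_smul, zero_comp, smul_zero, add_zero, smul_add]
  · simp only [Preadditive.comp_add, Preadditive.add_comp, E.inl_lst, E.inr_lst,
      Category.assoc,
      reassoc_of% hM, reassoc_of% huc, M.ofMul_lst_assoc, N.ofMul_lst_assoc, Linear.smul_comp,
      Linear.comp_smul, zero_comp, add_zero, smul_add]
  · have e1 := congrArg (fun z => z ≫ E.inl _) (h.mid k hk)
    have e2 := congrArg (fun z => z ≫ E.inr _) (h'.mid k hk)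
    simp only [Preadditive.sub_comp, Preadditive.add_comp, Category.assoc, Category.id_comp]
      at e1 e2
    apply E.hom_ext'
    · simp only [Preadditive.comp_add, Preadditive.add_comp, Preadditive.comp_sub,
        reassoc_of% E.inl_map, E.inl_map, E.inr_map,
        reassoc_of% E.inl_fst, reassoc_of% E.inl_snd, reassoc_of% E.inr_fst,
        reassoc_of% E.inr_snd, Category.assoc, Category.comp_id,
        reassoc_of% hM, reassoc_of% hN, reassoc_of% huu, reassoc_of% h2, reassoc_of% h1',
        negOnePow_smul_smul,
        biprod.inl_fst_assoc, biprod.inl_snd_assoc, biprod.inr_fst_assoc, biprod.inr_snd_assoc,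
        zero_comp, comp_zero, smul_zero, add_zero, zero_add, smul_add,
        Linear.smul_comp, Linear.comp_smul]
      rw [add_right_comm, ← e1, hu']
      abel
    · simp only [Preadditive.comp_add, Preadditive.add_comp, Preadditive.comp_sub,
        reassoc_of% E.inr_map, E.inl_map, E.inr_map,
        reassoc_of% E.inr_fst,
        reassoc_of% E.inr_snd, Category.assoc, Category.comp_id,
        reassoc_of% hM, M.ofMul_map_assoc, N.map_to_assoc, reassoc_of% hww,
        negOnePow_smul_smul,
        biprod.inl_fst_assoc, biprod.inl_snd_assoc, biprod.inr_fst_assoc, biprod.inr_snd_assoc,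
        zero_comp, comp_zero, smul_zero, add_zero, zero_add, smul_add,
        Linear.smul_comp, Linear.comp_smul]
      refine eq_add_of_add_eq_zero (negOnePow_add_succ_smul _ _) e2 ?_
      rw [hw']
      abel
  · have e1 := congrArg (fun z => z ≫ E.inl _) (h.zero)
    have e2 := congrArg (fun z => z ≫ E.inr _) (h'.zero)
    simp only [Preadditive.sub_comp, Preadditive.add_comp, Category.assoc, Category.id_comp]
      at e1 e2
    apply E.hom_ext'
    · simp only [Preadditive.comp_add, Preadditive.add_comp, Preadditive.comp_sub,
        E.inl_map, E.inr_map,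
        reassoc_of% E.inl_lst,
        reassoc_of% E.inl_fst, reassoc_of% E.inl_snd, reassoc_of% E.inr_fst,
        reassoc_of% E.inr_snd, Category.assoc, Category.comp_id,
        reassoc_of% hM, reassoc_of% hN, reassoc_of% huu, reassoc_of% h2, reassoc_of% h3',
        negOnePow_smul_smul,
        biprod.inl_fst_assoc, biprod.inl_snd_assoc, biprod.inr_fst_assoc, biprod.inr_snd_assoc,
        zero_comp, comp_zero, smul_zero, add_zero, zero_add, smul_add,
        Linear.smul_comp, Linear.comp_smul]
      rw [add_right_comm, ← e1, hu']
      abel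
    · simp only [Preadditive.comp_add, Preadditive.add_comp, Preadditive.comp_sub,
        E.inl_map, E.inr_map,
        reassoc_of% E.inr_lst,
        reassoc_of% E.inr_fst,
        reassoc_of% E.inr_snd, Category.assoc, Category.comp_id,
        reassoc_of% hM, M.ofMul_map_assoc, N.lst_to_assoc, reassoc_of% hww,
        negOnePow_smul_smul,
        biprod.inl_fst_assoc, biprod.inl_snd_assoc, biprod.inr_fst_assoc, biprod.inr_snd_assoc,
        zero_comp, comp_zero, smul_zero, add_zero, zero_add, smul_add,
        Linear.smul_comp, Linear.comp_smul]
      refine eq_add_of_add_eq_zero (add_negOnePow_one_smul _) e2 ?_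
      rw [hw']
      abel
  · have e1 := congrArg (fun z => z ≫ E.inl _) (h.last)
    have e2 := congrArg (fun z => z ≫ E.inr _) (h'.last)
    simp only [Preadditive.sub_comp, Preadditive.add_comp, Category.assoc, Category.id_comp]
      at e1 e2
    apply E.hom_ext'
    · simp only [Preadditive.comp_add, Preadditive.add_comp, Preadditive.comp_sub,
        reassoc_of% E.inl_map,
        E.inl_lst, E.inr_lst,
        reassoc_of% E.inl_fst, reassoc_of% E.inl_snd, reassoc_of% E.inr_fst,
        reassoc_of% E.inr_snd, Category.assoc, Category.comp_id,
        reassoc_of% hM, reassoc_of% hN, reassoc_of% huu, reassoc_of% h4, reassoc_of% h1',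
        negOnePow_smul_smul,
        biprod.inl_fst_assoc, biprod.inl_snd_assoc, biprod.inr_fst_assoc, biprod.inr_snd_assoc,
        zero_comp, comp_zero, smul_zero, add_zero, zero_add,
        Linear.smul_comp, Linear.comp_smul]
      refine Eq.trans ?_ (add_right_comm _ _ _)
      refine Eq.trans ?_ (congrArg (· + _) e1)
      rw [hu']
      abel
    · simp only [Preadditive.comp_add, Preadditive.add_comp, Preadditive.comp_sub,
        reassoc_of% E.inr_map,
        E.inl_lst, E.inr_lst,
        reassoc_of% E.inr_fst,
        reassoc_of% E.inr_snd, Category.assoc, Category.comp_id,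
        reassoc_of% hM, N.map_to_assoc, M.ofMul_lst_assoc, reassoc_of% hww,
        biprod.inl_fst_assoc, biprod.inl_snd_assoc, biprod.inr_fst_assoc, biprod.inr_snd_assoc,
        zero_comp, comp_zero, add_zero, zero_add,
        Linear.smul_comp, Linear.comp_smul]
      refine eq_add_of_add_eq_zero (negOnePow_smul_add_eq_zero hs _) e2 ?_
      rw [hw']
      abel

end Seq

end

/-! ### Mapping cones as extensions -/

section

namespace Seq

variable {C : Type u} [Category.{v} C] [Preadditive C] {R : Type w} [CommRing R] [Linear R C]
  {m : ℕ} {p : R}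

theorem neg_comp_negOnePow_smul_id (k : ℕ) {X Y : C} (f : X ⟶ Y) :
    (-f) ≫ (((-1 : ℤ) ^ k) • 𝟙 Y) = (((-1 : ℤ) ^ (k + 1)) • 𝟙 X) ≫ f := by
  simp [pow_succ]

theorem comp_negOnePow_smul_id (k : ℕ) {X Y : C} (f : X ⟶ Y) :
    f ≫ (((-1 : ℤ) ^ k) • 𝟙 Y) = (((-1 : ℤ) ^ (k + 1)) • 𝟙 X) ≫ (-f) := by
  simp [pow_succ]

theorem neg_comp_negOnePow_smul_id' (k : ℕ) {X Y : C} (f : X ⟶ Y) :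
    (-f) ≫ (((-1 : ℤ) ^ k) • 𝟙 Y) = (((-1 : ℤ) ^ 0) • 𝟙 X) ≫ (((-1 : ℤ) ^ (k + 1)) • f) := by
  simp [pow_succ]

theorem negOnePow_smul_comp_negOnePow_smul_id (k : ℕ) {X Y : C} (f : X ⟶ Y) :
    (((-1 : ℤ) ^ (k + 1)) • f) ≫ (((-1 : ℤ) ^ k) • 𝟙 Y) = (((-1 : ℤ) ^ 0) • 𝟙 X) ≫ (-f) := by
  rw [pow_succ, mul_smul, neg_one_zsmul, Preadditive.zsmul_comp, Preadditive.comp_zsmul,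
    negOnePow_smul_smul]
  simp

theorem negOnePow_smul_id_comp (k : ℕ) {X Y : C} (f : X ⟶ Y) :
    (((-1 : ℤ) ^ k) • 𝟙 X) ≫ f = ((-1 : ℤ) ^ k) • f := by
  simp

theorem negOnePow_smul_zsmul_comp (k : ℕ) {X Y Z : C} (f : X ⟶ Y) (g : Y ⟶ Z) :
    ((-1 : ℤ) ^ k) • ((((-1 : ℤ) ^ k) • f) ≫ g) = f ≫ g := by
  rw [Preadditive.zsmul_comp, negOnePow_smul_smul]

theorem neg_comp_add_add {X Y Z : C} {a : X ⟶ Y} {x : Y ⟶ Z} {f g y : X ⟶ Z}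
    (h : g = a ≫ x + y) : (-a) ≫ x + (f + g) = f + y := by
  rw [h, Preadditive.neg_comp]
  abel

theorem neg_comp_add_eq_zero {X Y Z : C} {a : X ⟶ Y} {x : Y ⟶ Z} {y : X ⟶ Z}
    (h : a ≫ x = y) : (-a) ≫ x + y = 0 := by
  rw [h.symm, Preadditive.neg_comp, neg_add_cancel]

/-- Replace the connecting family by an equal one. -/
def Extension.congr {P Q D : Seq (𝟭 C) m}
    {t t' : ∀ k (h : k + 1 < m + 3), P.obj ⟨k + 1, h⟩ ⟶ Q.obj ⟨k, Nat.lt_of_succ_lt h⟩}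
    {tl tl' : P.obj ⟨0, Nat.succ_pos _⟩ ⟶ Q.obj ⟨m + 2, Nat.lt_succ_self _⟩}
    (E : Extension P Q D t tl) (h : ∀ k hk, t k hk = t' k hk) (hl : tl = tl') :
    Extension P Q D t' tl' where
  __ := E
  map_snd k hk := by rw [E.map_snd, h]
  lst_snd := by
    subst hl
    exact E.lst_snd

/-- The left rotation with all maps, including the last one, negated. -/
def negRotate (A : Seq (𝟭 C) m) : Seq (𝟭 C) m where
  obj := A.rotate.obj
  map k h := -A.rotate.map k h
  last := -A.map (m + 1) (Nat.lt_succ_self _)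

/-- The isomorphism from the negated to the left rotation with components of alternating sign. -/
def negRotateTo (A : Seq (𝟭 C) m) : Hom A.negRotate A.rotate :=
  Hom.mk' (fun k => ((-1 : ℤ) ^ (k : ℕ)) • 𝟙 (A.rotate.obj k))
    (fun k _ => neg_comp_negOnePow_smul_id k _)
    (neg_comp_negOnePow_smul_id' (m + 2) (A.map (m + 1) (Nat.lt_succ_self _)))

/-- The inverse of `negRotateTo`. -/
def negRotateOf (A : Seq (𝟭 C) m) : Hom A.rotate A.negRotate :=
  Hom.mk' (fun k => ((-1 : ℤ) ^ (k : ℕ)) • 𝟙 (A.rotate.obj k))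
    (fun k _ => comp_negOnePow_smul_id k _)
    (negOnePow_smul_comp_negOnePow_smul_id (m + 2) (A.map (m + 1) (Nat.lt_succ_self _)))

theorem negRotateTo_comp_negRotateOf (A : Seq (𝟭 C) m) (k) :
    A.negRotateTo.app k ≫ A.negRotateOf.app k = 𝟙 _ := by
  change (((-1 : ℤ) ^ (k : ℕ)) • 𝟙 (A.rotate.obj k)) ≫ (((-1 : ℤ) ^ (k : ℕ)) • 𝟙 (A.rotate.obj k))
      = _
  rw [Preadditive.zsmul_comp, Preadditive.comp_zsmul, negOnePow_smul_smul, Category.comp_id]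
  rfl

theorem negRotateOf_comp_negRotateTo (A : Seq (𝟭 C) m) (k) :
    A.negRotateOf.app k ≫ A.negRotateTo.app k = 𝟙 _ := A.negRotateTo_comp_negRotateOf k

theorem IsCandidate.negRotate {A : Seq (𝟭 C) m} (hA : A.IsCandidate) :
    A.negRotate.IsCandidate :=
  (isCandidate_rotate_iff.2 hA).of_retract _ _ A.negRotateTo_comp_negRotateOf

/-- A strict retract of `A` yields one of the negated rotation. -/
theorem MulRetract.exists_negRotate {A : Seq (𝟭 C) m} {F : C}
    (hs : ((-1 : ℤ) ^ (m + 3)) • p = p) (M : MulRetract p A F)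
    (hM : ∀ k, M.ofMul k ≫ M.toMul k = 𝟙 _) :
    ∃ M' : MulRetract p A.negRotate F, (∀ k, M'.ofMul k ≫ M'.toMul k = 𝟙 _) ∧
      M'.toMul ⟨0, Nat.succ_pos _⟩ = M.toMul ⟨m + 2, Nat.lt_succ_self _⟩ ∧
      ∀ k (h : k + 1 < m + 3), M'.toMul ⟨k + 1, h⟩ =
        ((-1 : ℤ) ^ (k + 1)) • M.toMul ⟨k, Nat.lt_of_succ_lt h⟩ := by
  refine ⟨(M.rotate hs).ofRetract _ _ A.negRotateTo_comp_negRotateOf, fun k => ?_, ?_,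
    fun k h => ?_⟩
  · change ((M.rotate hs).ofMul k ≫ A.negRotateOf.app k) ≫
      A.negRotateTo.app k ≫ (M.rotate hs).toMul k = _
    rw [Category.assoc, reassoc_of% A.negRotateOf_comp_negRotateTo]
    obtain ⟨_ | k, hk⟩ := k
    · exact hM _
    · exact hM _
  · exact (negOnePow_smul_id_comp 0 (M.toMul _)).trans (one_smul _ _)
  · exact negOnePow_smul_id_comp (k + 1) (M.toMul _)

variable {A B : Seq (𝟭 C) m}

/-- Every diagonal family between candidates has a boundary. -/
theorem exists_hom_nullBy (hA : A.IsCandidate) (hB : B.IsCandidate)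
    (Θ : ∀ k (h : k + 1 < m + 3), A.obj ⟨k, Nat.lt_of_succ_lt h⟩ ⟶ B.obj ⟨k + 1, h⟩)
    (Λ : A.obj ⟨m + 2, Nat.lt_succ_self _⟩ ⟶ B.obj ⟨0, Nat.succ_pos _⟩) :
    ∃ χ : Hom A B, NullBy χ.app Θ Λ := by
  obtain ⟨f, hf, hf'⟩ := exists_extend_last (N := m + 1)
    (P := fun k h => A.obj ⟨k + 1, by omega⟩ ⟶ B.obj ⟨k + 1, by omega⟩)
    (fun k h => (A.map k (Nat.lt_succ_of_lt (Nat.succ_lt_succ h)) ≫ Θ k _ +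
      Θ (k + 1) (Nat.succ_lt_succ (Nat.succ_lt_succ h)) ≫ B.map (k + 1) _ :
      A.obj ⟨k + 1, Nat.lt_succ_of_lt (Nat.succ_lt_succ h)⟩ ⟶
        B.obj ⟨k + 1, Nat.lt_succ_of_lt (Nat.succ_lt_succ h)⟩))
    (A.map (m + 1) (Nat.lt_succ_self _) ≫ Θ (m + 1) (Nat.lt_succ_self _) + Λ ≫ B.lst)
  obtain ⟨φ, key⟩ : ∃ φ, NullBy (A := A) (B := B) φ Θ Λ :=
    ⟨rotFam (A.lst ≫ Λ + Θ 0 (by omega) ≫ B.map 0 (by omega)) fun k h => f k (by omega),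
      fun k hk => hf k (by omega) _, rfl, hf' _⟩
  refine ⟨Hom.mk' φ (fun k hk => ?_) ?_, key⟩
  · obtain rfl | hk' : k = m + 1 ∨ k < m + 1 := by omega
    · rw [key.last, key.mid m (by omega)]
      simp only [Preadditive.comp_add, Preadditive.add_comp, Category.assoc, hB.lst_map,
        reassoc_of% hA.map_map m (by omega), comp_zero, zero_comp, add_zero, zero_add]
    · rw [key.mid k (by omega)]
      cases k with
      | zero =>
        rw [key.zero]
        simp only [Preadditive.comp_add, Preadditive.add_comp, Category.assoc,
          reassoc_of% hA.map_lst, hB.map_map 0 (by omega), comp_zero, zero_comp, add_zero, zero_add]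
      | succ k =>
        rw [key.mid k (by omega)]
        simp only [Preadditive.comp_add, Preadditive.add_comp, Category.assoc,
          reassoc_of% hA.map_map k (by omega), hB.map_map (k + 1) (by omega), comp_zero, zero_comp,
          add_zero, zero_add]
  · rw [key.last, key.zero]
    simp only [Preadditive.comp_add, Preadditive.add_comp, Category.assoc,
      reassoc_of% hA.lst_map, hB.map_lst, comp_zero, zero_comp, add_zero, zero_add]

variable [HasBinaryBiproducts C]

theorem coneMap_fst {X X' Y Y' : C} (a : X ⟶ X') (f : X ⟶ Y') (b : Y ⟶ Y') :
    coneMap a f b ≫ biprod.fst = biprod.fst ≫ (-a) := by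
  apply biprod.hom_ext' <;> simp [coneMap]

theorem coneMap_snd {X X' Y Y' : C} (a : X ⟶ X') (f : X ⟶ Y') (b : Y ⟶ Y') :
    coneMap a f b ≫ biprod.snd = biprod.fst ≫ f + biprod.snd ≫ b := by
  apply biprod.hom_ext' <;> simp [coneMap]

theorem coneLast_fst {X Y Z W : C} (a : X ⟶ Z) (f : X ⟶ W) (b : Y ⟶ W) :
    biprod.desc ((-a) ≫ (biprod.inl : Z ⟶ Z ⊞ W) + f ≫ (biprod.inr : W ⟶ Z ⊞ W))
      (b ≫ (biprod.inr : W ⟶ Z ⊞ W)) ≫ biprod.fst = biprod.fst ≫ (-a) := by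
  apply biprod.hom_ext' <;> simp

theorem coneLast_snd {X Y Z W : C} (a : X ⟶ Z) (f : X ⟶ W) (b : Y ⟶ W) :
    biprod.desc ((-a) ≫ (biprod.inl : Z ⟶ Z ⊞ W) + f ≫ (biprod.inr : W ⟶ Z ⊞ W))
      (b ≫ (biprod.inr : W ⟶ Z ⊞ W)) ≫ biprod.snd = biprod.fst ≫ f + biprod.snd ≫ b := by
  apply biprod.hom_ext' <;> simp

/-- The mapping cone as an extension. -/
def coneExtension (φ : Hom A B) : Extension A.negRotate B (cone φ)
    (fun k h => φ.app ⟨k, Nat.lt_of_succ_lt h⟩) φ.φ₁ where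
  inl k := (biprod.inl : A.rotate.obj k ⟶ A.rotate.obj k ⊞ B.obj k)
  inr k := (biprod.inr : B.obj k ⟶ A.rotate.obj k ⊞ B.obj k)
  fst k := (biprod.fst : A.rotate.obj k ⊞ B.obj k ⟶ A.rotate.obj k)
  snd k := (biprod.snd : A.rotate.obj k ⊞ B.obj k ⟶ B.obj k)
  inl_fst _ := biprod.inl_fst
  inl_snd _ := biprod.inl_snd
  inr_fst _ := biprod.inr_fst
  inr_snd _ := biprod.inr_snd
  total _ := biprod.total
  map_fst _ _ := coneMap_fst _ _ _
  map_snd _ _ := coneMap_snd _ _ _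
  lst_fst := coneLast_fst A.α₁ φ.φ₁ B.lst
  lst_snd := coneLast_snd A.α₁ φ.φ₁ B.lst

theorem IsCandidate.cone (hA : A.IsCandidate) (hB : B.IsCandidate) (φ : Hom A B) :
    (cone φ).IsCandidate := by
  exact (coneExtension φ).isCandidate hA.negRotate hB
    (fun k hk => neg_comp_add_eq_zero (φ.comm k (by omega))) (neg_comp_add_eq_zero φ.comm_lst)
    (neg_comp_add_eq_zero (φ.comm (m + 1) (by omega)))

/-- Homotopic morphisms have isomorphic mapping cones. -/
theorem cone_isomorphic (φ χ : Hom A B) {Θ Λ} (h : NullBy χ.app Θ Λ) :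
    (cone (φ.add χ)).Isomorphic (cone φ) := by
  refine (coneExtension (φ.add χ)).isomorphic (coneExtension φ) (rotFam Λ fun k hk => Θ k hk)
    (fun k hk => ?_) ?_
  · cases k with
    | zero => exact neg_comp_add_add h.zero
    | succ k => exact neg_comp_add_add (h.mid k (by omega))
  · exact neg_comp_add_add h.last

/-- The morphism of sequences which factors through a morphism of constant sequences. -/
def through {F G : C} (M : MulRetract p A F) (c : F ⟶ G) (N : MulRetract p B G) : Hom A B :=
  Hom.mk' (fun k => M.toMul k ≫ c ≫ N.ofMul k)
    (fun k h => by
      simp only [M.map_to_assoc, N.ofMul_map, Category.assoc, Linear.smul_comp, Linear.comp_smul])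
    (by
      simp only [M.lst_to_assoc, N.ofMul_lst, Category.assoc, Linear.smul_comp, Linear.comp_smul])

/-- The cone is an extension of the negated rotation of A by B. Passing to the negated rotation
introduces alternating signs into the retraction onto F, and these are the signs required of the
connecting family. -/
theorem nonempty_mulRetract_cone_through {F G : C}
    (hs : ((-1 : ℤ) ^ (m + 3)) • p = p) (M : MulRetract p A F)
    (hM : ∀ k, M.ofMul k ≫ M.toMul k = 𝟙 _) (N : MulRetract p B G)
    (hN : ∀ k, N.ofMul k ≫ N.toMul k = 𝟙 _) (c : F ⟶ G) (s : G ⟶ F) (hc : c ≫ s ≫ c = c) :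
    Nonempty (MulRetract p (cone (through M c N)) (F ⊞ G)) := by
  obtain ⟨M', hM', h0, h1⟩ := M.exists_negRotate hs hM
  refine Extension.nonempty_mulRetract hs M' hM' N hN c s hc ?_
  refine (coneExtension (through M c N)).congr (fun k h => ?_) ?_
  · rw [h1]
    exact (negOnePow_smul_zsmul_comp (k + 1) (M.toMul _) (c ≫ N.ofMul _)).symm
  · rw [h0]
    rfl

end Seq

end

/-! ### Completing squares: axioms (N3) and (N4) -/

section

variable {C : Type u} [Category.{v} C] [Preadditive C] {R : Type w} [CommRing R] [Linear R C]
  {m : ℕ} {p : R}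

/-- A commutative square between initial segments of homotopy retracts is, up to homotopy, induced
by a von Neumann regular morphism. -/
theorem IsUniformScalar.exists_diagonals (hp : IsUniformScalar C p)
    {A₁ A₂ A₃ Aₙ B₁ B₂ B₃ Bₙ F G : C} {α₁ : A₁ ⟶ A₂} {α₂ : A₂ ⟶ A₃} {αₙ : Aₙ ⟶ A₁}
    {β₁ : B₁ ⟶ B₂} {β₂ : B₂ ⟶ B₃} {βₙ : Bₙ ⟶ B₁} (hα : αₙ ≫ α₁ = 0) (hβ : β₁ ≫ β₂ = 0)
    {f₁ : A₁ ⟶ F} {f₂ : A₂ ⟶ F} {f₃ : A₃ ⟶ F} {g₁ : F ⟶ A₁} {g₂ : F ⟶ A₂}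
    {f₁' : B₁ ⟶ G} {f₂' : B₂ ⟶ G} {g₁' : G ⟶ B₁} {g₂' : G ⟶ B₂} {gₙ' : G ⟶ Bₙ}
    (hf₁ : α₁ ≫ f₂ = p • f₁) (hf₂ : α₂ ≫ f₃ = p • f₂) (hg₁ : g₁ ≫ α₁ = p • g₂)
    (hf₁' : β₁ ≫ f₂' = p • f₁') (hg₁' : g₁' ≫ β₁ = p • g₂') (hgₙ' : gₙ' ≫ βₙ = p • g₁')
    {d₁ : A₂ ⟶ A₁} {d₂ : A₃ ⟶ A₂} {dₙ : A₁ ⟶ Aₙ} {d₁' : B₂ ⟶ B₁} {d₂' : B₃ ⟶ B₂} {dₙ' : B₁ ⟶ Bₙ}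
    (hA₁ : 𝟙 A₁ - f₁ ≫ g₁ = α₁ ≫ d₁ + dₙ ≫ αₙ) (hA₂ : 𝟙 A₂ - f₂ ≫ g₂ = α₂ ≫ d₂ + d₁ ≫ α₁)
    (hB₁ : 𝟙 B₁ - f₁' ≫ g₁' = β₁ ≫ d₁' + dₙ' ≫ βₙ)
    (hB₂ : 𝟙 B₂ - f₂' ≫ g₂' = β₂ ≫ d₂' + d₁' ≫ β₁)
    (a₁ : A₁ ⟶ B₁) (a₂ : A₂ ⟶ B₂) (h : α₁ ≫ a₂ = a₁ ≫ β₁) :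
    ∃ (c : F ⟶ G) (s : G ⟶ F), c ≫ s ≫ c = c ∧ ∃ (x₁ : A₂ ⟶ B₁) (x₂ : A₃ ⟶ B₂) (xₙ : A₁ ⟶ Bₙ),
      a₁ = f₁ ≫ c ≫ g₁' + (α₁ ≫ x₁ + xₙ ≫ βₙ) ∧
      a₂ = f₂ ≫ c ≫ g₂' + (α₂ ≫ x₂ + x₁ ≫ β₁) := by
  obtain ⟨ψ, hψ⟩ : ∃ ψ, ψ = g₁ ≫ a₁ ≫ f₁' := ⟨_, rfl⟩
  obtain ⟨s, hs, hs'⟩ := hp.exists_quasi_inverse ψ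
  -- From s ψ s = s it follows that c s c = c exactly, while c is still congruent to ψ modulo p. The
  -- morphism induced by a₂ is congruent to c as well, since the square commutes.
  obtain ⟨c, hc⟩ : ∃ c, c = ψ ≫ s ≫ ψ := ⟨_, rfl⟩
  rw [← hc] at hs'
  obtain ⟨θ₁, hθ₁⟩ := hp.exists_eq_add_smul hs'.symm
  obtain ⟨θ₂, hθ₂⟩ := hp.exists_eq_add_smul (x := g₂ ≫ a₂ ≫ f₂') (y := c) (by
    rw [hs', hψ, ← Linear.smul_comp, ← hg₁, Category.assoc, reassoc_of% h, hf₁',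
      Linear.comp_smul, Linear.comp_smul])
  obtain ⟨y, hy⟩ := hp.exists_eq_smul (g₂ ≫ a₂ ≫ β₂) (by
    rw [← Linear.smul_comp, ← hg₁, Category.assoc, reassoc_of% h, hβ, comp_zero, comp_zero])
  obtain ⟨z, hz⟩ := hp.exists_eq_smul (αₙ ≫ a₁ ≫ f₁') (by
    rw [← Linear.comp_smul, ← Linear.comp_smul, ← hf₁', ← reassoc_of% h, reassoc_of% hα, zero_comp])
  -- αₙ ≫ a₁ is killed by β₁, so the homotopy on B₁ leaves a term through βₙ and a term through G.
  -- The latter is a multiple of p, and p g₁' = gₙ' ≫ βₙ.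
  have hz' : αₙ ≫ a₁ = (z ≫ gₙ' + αₙ ≫ a₁ ≫ dₙ') ≫ βₙ := by
    have e1 := congrArg (fun t => αₙ ≫ a₁ ≫ t) hB₁
    have e2 := congrArg (fun t => t ≫ g₁') hz
    simp only [Preadditive.comp_sub, Preadditive.comp_add, Category.comp_id, ← reassoc_of% h,
      reassoc_of% hα, zero_comp, zero_add, Category.assoc, Linear.smul_comp] at e1 e2
    rw [sub_eq_iff_eq_add] at e1
    rw [Preadditive.add_comp, Category.assoc, Category.assoc, Category.assoc, hgₙ',
      Linear.comp_smul, ← e2, e1, add_comm]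
  -- Expand aᵢ with the homotopy of A, then the part through F with that of B. Up to the
  -- factorisations through p, the terms in d and d' are the resulting boundary terms; those in θ
  -- absorb the difference from c. As x₁ occurs in both equations and already contributes θ₁ to the
  -- second, x₂ carries θ₂ - θ₁.
  refine ⟨c, s, ?_, f₂ ≫ θ₁ ≫ g₁' + f₂ ≫ g₂ ≫ a₂ ≫ d₁' + d₁ ≫ a₁,
    f₃ ≫ (θ₂ - θ₁) ≫ g₂' + f₃ ≫ y ≫ d₂' + d₂ ≫ a₂,
    f₁ ≫ g₁ ≫ a₁ ≫ dₙ' + dₙ ≫ (z ≫ gₙ' + αₙ ≫ a₁ ≫ dₙ'), ?_, ?_⟩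
  · simp only [hc, Category.assoc]
    rw [reassoc_of% hs, reassoc_of% hs]
  · have e1 := congrArg (fun t => t ≫ a₁) hA₁
    have e2 := congrArg (fun t => f₁ ≫ g₁ ≫ a₁ ≫ t) hB₁
    have e3 := congrArg (fun t => f₁ ≫ t ≫ g₁') (hψ.symm.trans hθ₁)
    simp only [Preadditive.comp_sub, Preadditive.comp_add, Preadditive.sub_comp,
      Preadditive.add_comp, Category.comp_id, Category.id_comp, Category.assoc, Linear.smul_comp,
      Linear.comp_smul, hz', ← reassoc_of% h, reassoc_of% hg₁, sub_eq_iff_eq_add] at e1 e2 e3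
    simp only [Preadditive.comp_add, Preadditive.add_comp, Category.assoc, reassoc_of% hf₁,
      Linear.smul_comp]
    refine e1.trans ?_
    rw [e2, e3]
    abel
  · have e1 := congrArg (fun t => t ≫ a₂) hA₂
    have e2 := congrArg (fun t => f₂ ≫ g₂ ≫ a₂ ≫ t) hB₂
    have e3 := congrArg (fun t => f₂ ≫ t ≫ g₂') hθ₂
    simp only [Preadditive.comp_sub, Preadditive.comp_add, Preadditive.sub_comp,
      Preadditive.add_comp, Category.comp_id, Category.id_comp, Category.assoc, Linear.smul_comp,
      Linear.comp_smul, reassoc_of% hy, sub_eq_iff_eq_add] at e1 e2 e3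
    simp only [Preadditive.comp_add, Preadditive.add_comp, Preadditive.comp_sub,
      Preadditive.sub_comp, Category.assoc, reassoc_of% hf₂, ← h, hg₁',
      Linear.smul_comp, Linear.comp_smul]
    refine e1.trans ?_
    rw [e2, e3]
    abel

namespace Seq

variable [HasBinaryBiproducts C] [IsIdempotentComplete C] {A B : Seq (𝟭 C) m}

theorem exists_hom_cone_mem_mulAngles (hp : IsUniformScalar C p)
    (hs : ((-1 : ℤ) ^ (m + 3)) • p = p) (hA : A ∈ mulAngles C m p) (hB : B ∈ mulAngles C m p)
    (a₁ : A.X₁ ⟶ B.X₁) (a₂ : A.X₂ ⟶ B.X₂) (h : A.α₁ ≫ a₂ = a₁ ≫ B.α₁) :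
    ∃ φ : Hom A B, φ.φ₁ = a₁ ∧ φ.φ₂ = a₂ ∧ cone φ ∈ mulAngles C m p := by
  obtain ⟨hA, _, ⟨M⟩⟩ := hA
  obtain ⟨hB, _, ⟨N⟩⟩ := hB
  obtain ⟨F, M, hM⟩ := M.exists_strict hp
  obtain ⟨G, N, hN⟩ := N.exists_strict hp
  obtain ⟨Θ, Λ, hΘ⟩ := M.null
  obtain ⟨Θ', Λ', hΘ'⟩ := N.null
  obtain ⟨c, s, hc, x₁, x₂, xₙ, h₁, h₂⟩ := hp.exists_diagonals hA.lst_map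
    (hB.map_map m (by omega)) (M.map_to (m + 1) (by omega)) (M.map_to m (by omega))
    (M.ofMul_map (m + 1) (by omega)) (N.map_to (m + 1) (by omega)) (N.ofMul_map (m + 1) (by omega))
    N.ofMul_lst hΘ.last (hΘ.mid m (by omega)) hΘ'.last (hΘ'.mid m (by omega)) a₁ a₂ h
  -- Only the diagonals x₁, x₂ and xₙ affect the components at A₁ and A₂. The others are free and
  -- are taken to be zero.
  obtain ⟨x, -, hx⟩ := exists_extend_last (N := m)
    (P := fun k h => A.obj ⟨k, by omega⟩ ⟶ B.obj ⟨k + 1, by omega⟩) (fun k h => 0) x₂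
  obtain ⟨x, hx', hx''⟩ := exists_extend_last (N := m + 1)
    (P := fun k h => A.obj ⟨k, by omega⟩ ⟶ B.obj ⟨k + 1, by omega⟩) x x₁
  obtain ⟨χ, hχ⟩ := exists_hom_nullBy hA hB (fun k h => x k (by omega)) xₙ
  have hχ₁ := hχ.last
  have hχ₂ := hχ.mid m (by omega)
  rw [hx''] at hχ₁ hχ₂
  rw [hx' m (by omega), hx] at hχ₂
  refine ⟨(through M c N).add χ, ?_, ?_, ?_⟩
  · exact (congrArg _ hχ₁).trans h₁.symm
  · exact (congrArg _ hχ₂).trans h₂.symm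
  · exact mem_mulAngles_of_isomorphic (cone_isomorphic _ χ hχ) ⟨hA.cone hB _, _,
      nonempty_mulRetract_cone_through hs M hM N hN c s hc⟩

end Seq

end

/-! ### Free modules over the local ring -/

section

/-- Linear maps over a field are von Neumann regular. -/
theorem exists_comp_comp_eq {K V W : Type*} [Field K] [AddCommGroup V] [Module K V]
    [AddCommGroup W] [Module K W] (f : V →ₗ[K] W) : ∃ g : W →ₗ[K] V, f ∘ₗ g ∘ₗ f = f := by
  obtain ⟨r, hr⟩ := f.rangeRestrict.exists_rightInverse_of_surjective f.range_rangeRestrict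
  obtain ⟨g, hg⟩ := LinearMap.exists_extend r
  refine ⟨g, LinearMap.ext fun v => ?_⟩
  have h1 := LinearMap.congr_fun hg (f.rangeRestrict v)
  have h2 := congrArg Subtype.val (LinearMap.congr_fun hr (f.rangeRestrict v))
  change g (f v) = r (f.rangeRestrict v) at h1
  change f (r (f.rangeRestrict v)) = f v at h2
  change f (g (f v)) = f v
  rw [h1, h2]

/-- Matrices over a field are von Neumann regular. -/
theorem exists_matrix_mul_mul_eq {K ι κ : Type*} [Field K] [Fintype ι] [Fintype κ]
    (A : Matrix κ ι K) : ∃ S : Matrix ι κ K, A * (S * A) = A := by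
  classical
  obtain ⟨g, hg⟩ := exists_comp_comp_eq A.toLin'
  refine ⟨g.toMatrix', ?_⟩
  have := congrArg LinearMap.toMatrix' hg
  simpa [LinearMap.toMatrix'_comp] using this

/-- If the annihilator of `p` is generated by `p`, the same holds for the action of `p` on linear
maps between finite free modules. -/
theorem exists_eq_smul_of_smul_eq_zero {R : Type u} [CommRing R] {p : R}
    (hp : ∀ r : R, p * r = 0 → ∃ s, r = p * s)
    {V W : Type*} [AddCommGroup V] [Module R V] [Module.Finite R V] [Module.Free R V]
    [AddCommGroup W] [Module R W] [Module.Finite R W] [Module.Free R W] (f : V →ₗ[R] W)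
    (h : p • f = 0) : ∃ g, f = p • g := by
  classical
  let e := LinearMap.toMatrix (Module.Free.chooseBasis R V) (Module.Free.chooseBasis R W)
  have h' : ∀ i j, ∃ s, e f i j = p * s := fun i j => hp _ (by
    rw [← smul_eq_mul, ← Matrix.smul_apply, ← map_smul, h, map_zero, Matrix.zero_apply])
  choose T hT using h'
  refine ⟨e.symm (Matrix.of T), e.injective ?_⟩
  rw [map_smul, LinearEquiv.apply_symm_apply]
  ext i j
  exact hT i j

section Local

variable {R : Type u} [CommRing R] [IsLocalRing R] {p : R}

/-- Matrices over a local ring are von Neumann regular modulo the maximal ideal. -/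
theorem exists_matrix_mul_mul_eq_add_smul (hp : IsLocalRing.maximalIdeal R = Ideal.span {p})
    {ι κ : Type*} [Fintype ι] [Fintype κ] (A : Matrix κ ι R) :
    ∃ (S : Matrix ι κ R) (T : Matrix κ ι R), A * (S * A) = A + p • T := by
  obtain ⟨S', hS'⟩ := exists_matrix_mul_mul_eq (A.map (IsLocalRing.residue R))
  choose S hS using fun i j => IsLocalRing.residue_surjective (S' i j)
  have hS : Matrix.map (Matrix.of S) (IsLocalRing.residue R) = S' := by
    ext i j
    exact hS i j
  have h : ∀ i j, ∃ t, (A * (Matrix.of S * A)) i j - A i j = p * t := fun i j => by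
    rw [← dvd_def, ← Ideal.mem_span_singleton, ← hp, ← IsLocalRing.residue_eq_zero_iff, map_sub,
      sub_eq_zero, ← Matrix.map_apply (f := IsLocalRing.residue R), Matrix.map_mul, Matrix.map_mul,
      hS, hS', Matrix.map_apply]
  choose T hT using h
  refine ⟨Matrix.of S, Matrix.of T, ?_⟩
  ext i j
  rw [Matrix.add_apply, Matrix.smul_apply, Matrix.of_apply, smul_eq_mul, ← hT]
  ring

/-- Linear maps between finite free modules over a local ring are von Neumann regular modulo the
maximal ideal. -/
theorem exists_comp_comp_eq_add_smul (hp : IsLocalRing.maximalIdeal R = Ideal.span {p})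
    {V W : Type*} [AddCommGroup V] [Module R V] [Module.Finite R V] [Module.Free R V]
    [AddCommGroup W] [Module R W] [Module.Finite R W] [Module.Free R W] (f : V →ₗ[R] W) :
    ∃ (s : W →ₗ[R] V) (t : V →ₗ[R] W), f ∘ₗ s ∘ₗ f = f + p • t := by
  classical
  let b := Module.Free.chooseBasis R V
  let b' := Module.Free.chooseBasis R W
  obtain ⟨S, T, h⟩ := exists_matrix_mul_mul_eq_add_smul hp (LinearMap.toMatrix b b' f)
  refine ⟨Matrix.toLin b' b S, Matrix.toLin b b' T, ?_⟩
  apply (LinearMap.toMatrix b b').injective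
  rw [LinearMap.toMatrix_comp b b b', LinearMap.toMatrix_comp b b' b, LinearMap.toMatrix_toLin, h,
    map_add, map_smul, LinearMap.toMatrix_toLin]

/-- Otherwise r is a unit, which forces p = 0, contrary to the maximal ideal being nonzero. -/
theorem exists_eq_mul_of_mul_eq_zero (hp : IsLocalRing.maximalIdeal R = Ideal.span {p})
    (hp0 : IsLocalRing.maximalIdeal R ≠ ⊥) (r : R) (h : p * r = 0) : ∃ s, r = p * s := by
  rw [← dvd_def, ← Ideal.mem_span_singleton, ← hp, IsLocalRing.mem_maximalIdeal]
  intro hr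
  exact hp0 (by rw [hp, hr.mul_left_eq_zero.1 h, Ideal.span_singleton_eq_bot])

-- The image of an idempotent is a direct summand, hence finitely generated projective, hence free
-- over a local ring.
variable (R) in
instance : IsIdempotentComplete (FGFree R) where
  idempotents_split X q hq := by
    let f : X.obj →ₗ[R] X.obj := q.hom.hom
    have hf (x) : f (f x) = f x := LinearMap.congr_fun (congrArg (fun z => z.hom.hom) hq) x
    have := X.property.1
    have := X.property.2
    have hr : f.rangeRestrict ∘ₗ (LinearMap.range f).subtype = LinearMap.id := by
      ext ⟨_, x, rfl⟩
      exact hf x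
    have : Module.Projective R (LinearMap.range f) := .of_split _ _ hr
    have : Module.Free R (LinearMap.range f) := Module.free_of_flat_of_isLocalRing
    refine ⟨⟨ModuleCat.of R (LinearMap.range f), inferInstance, this⟩,
      ObjectProperty.homMk (ModuleCat.ofHom (LinearMap.range f).subtype),
      ObjectProperty.homMk (ModuleCat.ofHom f.rangeRestrict), ?_, ?_⟩
    · ext x
      exact congrArg Subtype.val (LinearMap.congr_fun hr x)
    · ext x
      rfl

theorem isUniformScalar_fgFree (hp : IsLocalRing.maximalIdeal R = Ideal.span {p})
    (hp0 : IsLocalRing.maximalIdeal R ≠ ⊥) (hsq : IsLocalRing.maximalIdeal R ^ 2 = ⊥) :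
    IsUniformScalar (FGFree R) p where
  mul_self := by
    rw [hp, Ideal.span_singleton_pow, Ideal.span_singleton_eq_bot] at hsq
    rw [← sq, hsq]
  exists_eq_smul {X Y} z hz := by
    have := X.property.1
    have := X.property.2
    have := Y.property.1
    have := Y.property.2
    obtain ⟨g, hg⟩ := exists_eq_smul_of_smul_eq_zero (exists_eq_mul_of_mul_eq_zero hp hp0)
      z.hom.hom (congrArg (fun z => z.hom.hom) hz)
    refine ⟨ObjectProperty.homMk (ModuleCat.ofHom g), ?_⟩
    ext x
    exact LinearMap.congr_fun hg x
  exists_regular {X Y} f := by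
    have := X.property.1
    have := X.property.2
    have := Y.property.1
    have := Y.property.2
    obtain ⟨s, t, h⟩ := exists_comp_comp_eq_add_smul hp f.hom.hom
    refine ⟨ObjectProperty.homMk (ModuleCat.ofHom s), ObjectProperty.homMk (ModuleCat.ofHom t), ?_⟩
    ext x
    exact LinearMap.congr_fun h x

theorem angles_eq_mulAngles (m : ℕ) (hp : IsUniformScalar (FGFree R) p) :
    angles m p = Seq.mulAngles (FGFree R) m p :=
  Set.ext fun _ => (Seq.mem_mulAngles_iff_exists_isomorphic hp).symm

theorem isNAngulated_mulAngles {C : Type u} [Category.{v} C] [Preadditive C] {S : Type w}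
    [CommRing S] [Linear S C] [HasZeroObject C] [HasBinaryBiproducts C] [IsIdempotentComplete C]
    {p : S} {m : ℕ} (hp : IsUniformScalar C p) (hs : ((-1 : ℤ) ^ (m + 3)) • p = p) :
    IsNAngulated (𝟭 C) (Seq.mulAngles C m p) where
  automorphism := ⟨𝟭 C, rfl, rfl⟩
  isomorphism_closed _ _ h hA := Seq.mem_mulAngles_of_isomorphic h.symm hA
  sum_closed _ _ := Seq.sum_mem_mulAngles
  summand_closed _ _ := Seq.mem_mulAngles_of_sum_mem
  trivial_mem := Seq.trivial_mem_mulAngles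
  exists_first _ _ f := (Seq.isFirst_of_isUniformScalar hp hs f).exists_arrow_eq
  rotate_mem_iff _ := (Seq.rotate_mem_mulAngles_iff hs).symm
  exists_hom _ hA _ hB f₁ f₂ h := by
    obtain ⟨φ, h₁, h₂, -⟩ := Seq.exists_hom_cone_mem_mulAngles hp hs hA hB f₁ f₂ h
    exact ⟨φ, h₁, h₂⟩
  exists_hom_cone _ hA _ hB := Seq.exists_hom_cone_mem_mulAngles hp hs hA hB

end Local

end

end NAngle

end

theorem theorem3p7 {R : Type*} [CommRing R] [IsLocalRing R] (p : R)
    (hp : IsLocalRing.maximalIdeal R = Ideal.span {p}) (hp0 : IsLocalRing.maximalIdeal R ≠ ⊥)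
    (hsq : IsLocalRing.maximalIdeal R ^ 2 = ⊥)
    (n m : ℕ) (hn : n = m + 3) (h : Even n ∨ (Odd n ∧ 2 * p = 0)) :
    NAngle.IsNAngulated (CategoryTheory.Functor.id (NAngle.FGFree R)) (NAngle.angles m p) := by
  have hU := NAngle.isUniformScalar_fgFree hp hp0 hsq
  rw [NAngle.angles_eq_mulAngles m hU]
  -- What remains is (-1)^n p = p: automatic for even n, and equivalent to 2p = 0 for odd n.
  refine NAngle.isNAngulated_mulAngles hU ?_
  subst hn
  obtain h | ⟨h, h2⟩ := h
  · rw [h.neg_one_pow, one_smul]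
  · rw [h.neg_one_pow, neg_one_zsmul, neg_eq_iff_add_eq_zero, ← two_mul, h2]
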